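/- Let $G$ be a compact Lie group with normalised Haar measure $\mu$, let $\widehat G$ be the set of unitary equivalence classes of continuous irreducible unitary representations of $G$, and choose for each class $[\xi]\in\widehat G$ a representative written, in an orthonormal basis, as a matrix-valued function $\xi:G\to\mathbb C^{d_\xi\times d_\xi}$. Let $0<r\le 1$, $1\le p<\infty$ and $\widetilde p=\min\{2,p\}$. Let $A:L^p(G)\to L^p(G)$ be a continuous linear operator, with matrix-valued symbol $$\sigma_A(x,\xi)=\xi(x)^*(A\xi)(x)\in\mathbb C^{d_\xi\times d_\xi},\qquad (A\xi)_{ij}=A(\xi_{ij}).$$ For $B\in\mathbb C^{d\times d}$ put $\|B\|_{op(\ell^\infty,\ell^\infty)}=\max_{1\le i\le d}\sum_{j=1}^d|B_{ij}|$, and let $B^t$ be the transpose of $B$. Suppose that $$\sum_{[\xi]\in\widehat G}d_\xi^{\,2+\frac r{\widetilde p}}\left(\int_G\|\sigma_A(x,\xi)^t\|_{op(\ell^\infty,\ell^\infty)}^p\,d\mu(x)\right)^{r/p}<\infty.$$ Then $A$ is $r$-nuclear on $L^p(G)$, that is, there are sequences $(x_n')$ in $L^p(G)'$ and $(y_n)$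 in $L^p(G)$ with $\sum_n\|x_n'\|^r\|y_n\|^r<\infty$ and $Af=\sum_n\langle f,x_n'\rangle y_n$ for all $f\in L^p(G)$. Moreover, the series $\sum_{[\xi]}d_\xi\operatorname{Tr}(\sigma_A(x,\xi))$ converges absolutely for almost every $x\in G$, its sum is integrable, and the nuclear trace of $A$ is $$\operatorname{Tr}A=\int_G\sum_{[\xi]\in\widehat G}d_\xi\operatorname{Tr}(\sigma_A(x,\xi))\,d\mu(x).$$ Here $\operatorname{Tr}A=\sum_n x_n'(y_n)$, which takes the same value for every representation $Af=\sum_n\langle f,x_n'\rangle y_n$ with $\sum_n\|x_n'\|\|y_n\|<\infty$. -/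

import Mathlib

open MeasureTheory
open scoped ENNReal Manifold ContDiff Matrix

noncomputable section

/-! ### `r`-nuclear operators and the nuclear trace -/

section Nuclear

variable {E F : Type*} [NormedAddCommGroup E] [NormedSpace ℂ E]
  [NormedAddCommGroup F] [NormedSpace ℂ F]

/-- The sequences `x' n ∈ E'` and `y n ∈ F` form an `r`-nuclear representation of `T`:
`T x = ∑ₙ ⟨x, x' n⟩ y n` for every `x`, and `∑ₙ ‖x' n‖ ^ r * ‖y n‖ ^ r < ∞`. -/
def IsNuclearRepresentation (r : ℝ) (T : E →L[ℂ] F) (x' : ℕ → (E →L[ℂ] ℂ)) (y : ℕ → F) : Prop :=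
  (∀ x : E, HasSum (fun n => x' n x • y n) (T x)) ∧
    Summable (fun n => ‖x' n‖ ^ r * ‖y n‖ ^ r)

/-- `T` is `r`-nuclear. -/
def IsRNuclear (r : ℝ) (T : E →L[ℂ] F) : Prop :=
  ∃ (x' : ℕ → (E →L[ℂ] ℂ)) (y : ℕ → F), IsNuclearRepresentation r T x' y

/-- `T` is nuclear (the case `r = 1`) and its trace is well defined and equal to `t`: for every
nuclear representation of `T`, the series `∑ₙ x' n (y n)` converges with sum `t`. -/
def HasNuclearTrace (T : E →L[ℂ] E) (t : ℂ) : Prop :=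
  IsRNuclear 1 T ∧
    ∀ (x' : ℕ → (E →L[ℂ] ℂ)) (y : ℕ → E), IsNuclearRepresentation 1 T x' y →
      HasSum (fun n => x' n (y n)) t

end Nuclear

/-! ### The unitary dual -/

/-- The action on column vectors `ℂᵈ` of a matrix representation. -/
def matrixRepresentation {G : Type*} [Group G] {d : ℕ}
    (φ : G →* Matrix.unitaryGroup (Fin d) ℂ) : Representation ℂ G (Fin d → ℂ) :=
  ((Matrix.toLinAlgEquiv' : Matrix (Fin d) (Fin d) ℂ ≃ₐ[ℂ] _) :
      Matrix (Fin d) (Fin d) ℂ →* ((Fin d → ℂ) →ₗ[ℂ] (Fin d → ℂ))).comp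
    ((Matrix.unitaryGroup (Fin d) ℂ).subtype.comp φ)

/-- A continuous irreducible unitary representation of `G`, written as a matrix-valued function
with respect to an orthonormal basis of the representation space. (For a compact group every
continuous irreducible unitary representation is finite-dimensional.) -/
structure UnitaryIrrep (G : Type*) [Group G] [TopologicalSpace G] where
  /-- The dimension of the representation space. -/
  dim : ℕ
  /-- The underlying homomorphism into the unitary group. -/
  toHom : G →* Matrix.unitaryGroup (Fin dim) ℂ
  continuous_mat : Continuous fun x : G => (toHom x : Matrix (Fin dim) (Fin dim) ℂ)
  irreducible_rep : (matrixRepresentation toHom).IsIrreducible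

namespace UnitaryIrrep

variable {G : Type*} [Group G] [TopologicalSpace G]

/-- The matrix `ξ(x)`. -/
def mat (ξ : UnitaryIrrep G) (x : G) : Matrix (Fin ξ.dim) (Fin ξ.dim) ℂ := ξ.toHom x

/-- The matrix coefficient `ξ_{ij}` as a continuous function on `G`. -/
def coeff (ξ : UnitaryIrrep G) (i j : Fin ξ.dim) : C(G, ℂ) where
  toFun x := ξ.mat x i j
  continuous_toFun := ξ.continuous_mat.matrix_elem i j

/-- Unitary equivalence: there is a unitary intertwining matrix. -/
def Equivalent (ξ η : UnitaryIrrep G) : Prop :=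
  ∃ U : Matrix (Fin η.dim) (Fin ξ.dim) ℂ,
    Uᴴ * U = 1 ∧ U * Uᴴ = 1 ∧ ∀ x : G, U * ξ.mat x = η.mat x * U

instance instSetoid (G : Type*) [Group G] [TopologicalSpace G] : Setoid (UnitaryIrrep G) where
  r := Equivalent
  iseqv :=
    { refl := fun ξ => ⟨1, by simp, by simp, by simp⟩
      symm := by
        rintro ξ η ⟨U, h1, h2, h3⟩
        refine ⟨Uᴴ, by simpa using h2, by simpa using h1, fun x => ?_⟩
        calc Uᴴ * η.mat x = Uᴴ * (η.mat x * U) * Uᴴ := by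
              rw [Matrix.mul_assoc, Matrix.mul_assoc, h2, Matrix.mul_one]
          _ = ξ.mat x * Uᴴ := by
              rw [← h3, ← Matrix.mul_assoc, h1, Matrix.one_mul]
      trans := by
        rintro ξ η ζ ⟨U, h1, h2, h3⟩ ⟨V, k1, k2, k3⟩
        refine ⟨V * U, ?_, ?_, fun x => ?_⟩
        · rw [Matrix.conjTranspose_mul, Matrix.mul_assoc, ← Matrix.mul_assoc Vᴴ, k1,
            Matrix.one_mul, h1]
        · rw [Matrix.conjTranspose_mul, Matrix.mul_assoc, ← Matrix.mul_assoc U, h2,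
            Matrix.one_mul, k2]
        · rw [Matrix.mul_assoc, h3, ← Matrix.mul_assoc, k3, Matrix.mul_assoc] }

end UnitaryIrrep

/-- The unitary dual `Ĝ`: equivalence classes of continuous irreducible unitary
representations. -/
def UnitaryDual (G : Type*) [Group G] [TopologicalSpace G] : Type _ :=
  Quotient (UnitaryIrrep.instSetoid G)

/-- The class `[ξ]` of a representation `ξ`. -/
def UnitaryIrrep.cls {G : Type*} [Group G] [TopologicalSpace G] (ξ : UnitaryIrrep G) :
    UnitaryDual G :=
  Quotient.mk (UnitaryIrrep.instSetoid G) ξ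

/-! ### The matrix-valued symbol -/

/-- The operator norm on `ℂᵈ` with the `ℓ^∞` norm, `max_i ∑_j |B_{ij}|`. -/
def opNormLinfty {d : ℕ} (B : Matrix (Fin d) (Fin d) ℂ) : ℝ :=
  ⨆ i, ∑ j, ‖B i j‖

section Symbol

variable {G : Type*} [Group G] [TopologicalSpace G] [CompactSpace G] [MeasurableSpace G]
  [BorelSpace G] {μ : Measure G} [IsFiniteMeasure μ] {p : ℝ≥0∞} [Fact (1 ≤ p)]

/-- The matrix-valued symbol `σ_A(x, ξ) = ξ(x)^* (Aξ)(x)`, where `(Aξ)_{ij} = A(ξ_{ij})`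
(determined for almost every `x`). -/
def matrixSymbol (A : Lp ℂ p μ →L[ℂ] Lp ℂ p μ) (ξ : UnitaryIrrep G) (x : G) :
    Matrix (Fin ξ.dim) (Fin ξ.dim) ℂ :=
  (ξ.mat x)ᴴ * Matrix.of fun i j => (A (ContinuousMap.toLp p μ ℂ (ξ.coeff i j)) : G → ℂ) x

end Symbol

end

/-! Write `p̃ = min(2, p)`. The nuclear representation is the Fourier expansion of `A`: formally `f
= ∑ d_ξ (∫ conj(ξ_ij) f) ξ_ij`, hence `A f = ∑ x'_{ξij}(f) A(ξ_ij)`, where `x'_{ξij}(f) = d_ξ ∫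
conj(ξ_ij) f`.

Two bounds make this series nuclear. Since `|ξ_ij| ≤ 1` and `∫ |ξ_ij|² = 1/d_ξ`, Hölder with
exponent `p̃` and its conjugate, which is at least 2, gives `‖x'_{ξij}‖ ≤ d_ξ^{1/p̃}`. Since `Aξ = ξ
σ_A` and `|ξ_ik| ≤ 1`, the norm of `A(ξ_ij)` is at most the `L^p` norm of `‖σ_Aᵗ‖`. Each class
contributes `d_ξ²` index pairs, which accounts for the weight `d_ξ^{2 + r/p̃}`.

As `r ≤ 1`, the rank-one series also converges in operator norm. By Schur orthogonality its sum
agrees with `A` on every matrix coefficient, and these span a dense subspace by the Peter–Weyl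
theorem, so the sum is `A`.

The trace does not depend on the representation because conditional expectations onto finite
σ-algebras give `L^p` the metric approximation property. In the Fourier representation `x'_{ξij}(A
ξ_ij)` is the integral of `d_ξ conj(ξ_ij) A(ξ_ij)`. Summing over `i, j` produces `d_ξ Tr σ_A`, and
Tonelli justifies exchanging sum and integral. -/

noncomputable section

/-! ### Nuclear representations and uniqueness of the trace under the approximation property. -/

section NuclearTrace

open Filter Topology

/-- The metric approximation property: the identity is the strong limit of a net of
contractions of finite rank. -/
def HasMetricApproximationProperty (E : Type*) [NormedAddCommGroup E] [NormedSpace ℂ E] : Prop :=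
  ∃ l : Filter (E →L[ℂ] E), l.NeBot ∧ (∀ᶠ R in l, ‖R‖ ≤ 1) ∧
    (∀ᶠ R in l, FiniteDimensional ℂ R.range) ∧ ∀ y, Tendsto (fun R => R y) l (𝓝 y)

variable {E F : Type*} [NormedAddCommGroup E] [NormedSpace ℂ E]
  [NormedAddCommGroup F] [NormedSpace ℂ F]

theorem ContinuousLinearMap.exists_eq_sum_of_finiteDimensional_range (R : E →L[ℂ] F)
    (h : FiniteDimensional ℂ R.range) :
    ∃ (m : ℕ) (φ : Fin m → E →L[ℂ] ℂ) (z : Fin m → F), ∀ x, R x = ∑ j, φ j x • z j := by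
  let b := Module.finBasis ℂ R.range
  let R' : E →L[ℂ] R.range := R.codRestrict R.range fun x => ⟨x, rfl⟩
  refine ⟨_, fun j => (LinearMap.toContinuousLinearMap (b.coord j)).comp R',
    fun j => (b j : F), fun x => ?_⟩
  have := congrArg (Subtype.val) (b.sum_repr (R' x))
  change R x = ∑ j, b.repr (R' x) j • (b j : F)
  rw [Submodule.coe_sum] at this
  exact this.symm

theorem IsNuclearRepresentation.summable_norm {T : E →L[ℂ] F} {x' : ℕ → E →L[ℂ] ℂ} {y : ℕ → F}
    (h : IsNuclearRepresentation 1 T x' y) : Summable fun n => ‖x' n‖ * ‖y n‖ := by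
  simpa using h.2

/-- All but finitely many terms are below 1, and there `a ≤ a ^ r`. -/
theorem Summable.of_rpow_of_le_one {ι : Type*} {a : ι → ℝ} (ha : ∀ i, 0 ≤ a i) {r : ℝ}
    (hr0 : 0 < r) (hr1 : r ≤ 1) (h : Summable fun i => a i ^ r) : Summable a := by
  have hlt := h.tendsto_cofinite_zero.eventually (gt_mem_nhds (zero_lt_one' ℝ))
  refine Summable.of_norm_bounded_eventually h ?_
  filter_upwards [hlt] with n hn
  rw [Real.norm_of_nonneg (ha n)]
  have h1 : a n ≤ 1 := by
    by_contra! hc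
    exact absurd hn (not_lt.2 (Real.one_le_rpow hc.le hr0.le))
  rcases (ha n).eq_or_lt with h0 | h0
  · rw [← h0]; positivity
  · simpa using Real.rpow_le_rpow_of_exponent_ge h0 h1 hr1

omit [NormedSpace ℂ F] in
theorem summable_norm_mul_norm_of_rpow {ι : Type*} {r : ℝ} (hr0 : 0 < r) (hr1 : r ≤ 1)
    {x' : ι → E →L[ℂ] ℂ} {y : ι → F} (h : Summable fun i => ‖x' i‖ ^ r * ‖y i‖ ^ r) :
    Summable fun i => ‖x' i‖ * ‖y i‖ :=
  Summable.of_rpow_of_le_one (fun i => by positivity) hr0 hr1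
    (by simpa only [Real.mul_rpow (norm_nonneg _) (norm_nonneg _)] using h)

theorem IsNuclearRepresentation.one_of_le_one {r : ℝ} (hr0 : 0 < r) (hr1 : r ≤ 1)
    {T : E →L[ℂ] F} {x' : ℕ → E →L[ℂ] ℂ} {y : ℕ → F}
    (h : IsNuclearRepresentation r T x' y) : IsNuclearRepresentation 1 T x' y :=
  ⟨h.1, by simpa only [Real.rpow_one] using summable_norm_mul_norm_of_rpow hr0 hr1 h.2⟩

theorem Function.Injective.map₂_extend_zero {ι κ A B M : Type*} [Zero A] [Zero B] [Zero M]
    {e : ι → κ} (he : Function.Injective e) (b : A → B → M) (hb : b 0 0 = 0) (f : ι → A)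
    (g : ι → B) :
    (fun n => b (Function.extend e f 0 n) (Function.extend e g 0 n)) =
      Function.extend e (fun i => b (f i) (g i)) 0 := by
  ext n
  by_cases hn : ∃ i, e i = n
  · obtain ⟨i, rfl⟩ := hn
    simp only [he.extend_apply]
  · simp only [Function.extend_apply' _ _ _ hn, Pi.zero_apply, hb]

/-- A nuclear representation indexed by a countable type can be indexed by `ℕ`. -/
theorem exists_isNuclearRepresentation_of_countable {ι : Type*} [Countable ι] {r : ℝ}
    (hr0 : 0 < r) {T : E →L[ℂ] F} (x' : ι → E →L[ℂ] ℂ) (y : ι → F)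
    (hT : ∀ x, HasSum (fun i => x' i x • y i) (T x))
    (h : Summable fun i => ‖x' i‖ ^ r * ‖y i‖ ^ r) :
    ∃ (X' : ℕ → E →L[ℂ] ℂ) (Y : ℕ → F), IsNuclearRepresentation r T X' Y ∧
      ∀ (B : (E →L[ℂ] ℂ) → F → ℂ) (t : ℂ), B 0 0 = 0 → HasSum (fun i => B (x' i) (y i)) t →
        HasSum (fun n => B (X' n) (Y n)) t := by
  obtain ⟨e, he⟩ := exists_injective_nat ι
  refine ⟨Function.extend e x' 0, Function.extend e y 0, ⟨fun x => ?_, ?_⟩, fun B t hB ht => ?_⟩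
  · rw [he.map₂_extend_zero (fun (φ : E →L[ℂ] ℂ) (v : F) => φ x • v) (by simp), hasSum_extend_zero he]
    exact hT x
  -- Positivity of `r` matters here: for `r = 0` each padded index would contribute `0 ^ 0 = 1`.
  · rw [he.map₂_extend_zero (fun (φ : E →L[ℂ] ℂ) (v : F) => ‖φ‖ ^ r * ‖v‖ ^ r)
      (by simp [Real.zero_rpow hr0.ne'])]
    exact ((hasSum_extend_zero he).2 h.hasSum).summable
  · rw [he.map₂_extend_zero B hB, hasSum_extend_zero he]
    exact ht

theorem summable_apply_of_summable_norm_mul_norm {x' : ℕ → F →L[ℂ] ℂ} {y : ℕ → F}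
    (h : Summable fun n => ‖x' n‖ * ‖y n‖) : Summable fun n => x' n (y n) :=
  Summable.of_norm_bounded h fun n => (x' n).le_opNorm _

/-- Traces the composite of `T` with the finite-rank operator `∑ φ j ⊗ z j`. The value involves only
`T`, not the representation chosen. -/
theorem IsNuclearRepresentation.tsum_finiteRank {T : E →L[ℂ] E} {x' : ℕ → E →L[ℂ] ℂ} {y : ℕ → E}
    (h : IsNuclearRepresentation 1 T x' y) {m : ℕ} (φ : Fin m → E →L[ℂ] ℂ) (z : Fin m → E) :
    HasSum (fun n => x' n (∑ j, φ j (y n) • z j)) (∑ j, φ j (T (z j))) := by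
  have h1 : ∀ j, HasSum (fun n => φ j (x' n (z j) • y n)) (φ j (T (z j))) := fun j =>
    (h.1 (z j)).mapL (φ j)
  convert hasSum_sum (s := Finset.univ) fun j _ => h1 j using 1
  ext n
  simp [map_sum, mul_comm]

/-- Inserting a finite-rank contraction `R` makes both sums equal. Dominated convergence, with
majorant `‖x n‖ * ‖y n‖`, then removes `R`. -/
theorem IsNuclearRepresentation.tsum_eq_tsum (hE : HasMetricApproximationProperty E)
    {T : E →L[ℂ] E} {x₁ x₂ : ℕ → E →L[ℂ] ℂ} {y₁ y₂ : ℕ → E}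
    (h₁ : IsNuclearRepresentation 1 T x₁ y₁) (h₂ : IsNuclearRepresentation 1 T x₂ y₂) :
    ∑' n, x₁ n (y₁ n) = ∑' n, x₂ n (y₂ n) := by
  obtain ⟨l, hl, hR1, hRf, hR⟩ := hE
  have key : ∀ {x : ℕ → E →L[ℂ] ℂ} {y : ℕ → E}, IsNuclearRepresentation 1 T x y →
      Tendsto (fun R => ∑' n, x n (R (y n))) l (𝓝 (∑' n, x n (y n))) := by
    intro x y h
    refine tendsto_tsum_of_dominated_convergence h.summable_norm (fun n => ?_) ?_
    · exact ((x n).continuous.tendsto _).comp (hR (y n))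
    · filter_upwards [hR1] with R hR n
      refine ((x n).le_opNorm _).trans ?_
      gcongr
      simpa using R.le_of_opNorm_le hR (y n)
  refine tendsto_nhds_unique (key h₁) ?_
  refine (key h₂).congr' ?_
  filter_upwards [hRf] with R hRf
  obtain ⟨m, φ, z, hφ⟩ := R.exists_eq_sum_of_finiteDimensional_range hRf
  simp only [hφ]
  rw [(h₁.tsum_finiteRank φ z).tsum_eq, (h₂.tsum_finiteRank φ z).tsum_eq]

theorem IsNuclearRepresentation.hasNuclearTrace (hE : HasMetricApproximationProperty E)
    {T : E →L[ℂ] E} {x' : ℕ → E →L[ℂ] ℂ} {y : ℕ → E}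
    (h : IsNuclearRepresentation 1 T x' y) : HasNuclearTrace T (∑' n, x' n (y n)) := by
  refine ⟨⟨x', y, h⟩, fun x₂ y₂ h₂ => ?_⟩
  rw [h.tsum_eq_tsum hE h₂]
  exact (summable_apply_of_summable_norm_mul_norm h₂.summable_norm).hasSum

end NuclearTrace

/-! ### Metric approximation property of `L^p` through conditional expectations. -/

section LpApproximation

open Filter Topology

variable {α : Type*} {m m0 : MeasurableSpace α} {μ : Measure α} [IsFiniteMeasure μ]
  {p : ℝ≥0∞} [Fact (1 ≤ p)]

/-- Conditional expectation as an operator on `L^p`. -/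
def condExpLp (p : ℝ≥0∞) [Fact (1 ≤ p)] (m : MeasurableSpace α) {m0 : MeasurableSpace α}
    (μ : Measure α) [IsFiniteMeasure μ] : Lp ℂ p μ →L[ℂ] Lp ℂ p μ :=
  LinearMap.mkContinuous
    { toFun := fun f => ((Lp.memLp f).condExp (m := m) Fact.out).toLp (μ[f | m])
      map_add' := fun f g => by
        rw [← MemLp.toLp_add, MemLp.toLp_eq_toLp_iff]
        exact (condExp_congr_ae (Lp.coeFn_add f g)).trans
          (condExp_add ((Lp.memLp f).integrable Fact.out) ((Lp.memLp g).integrable Fact.out) m)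
      map_smul' := fun c f => by
        rw [RingHom.id_apply, ← MemLp.toLp_const_smul, MemLp.toLp_eq_toLp_iff]
        exact (condExp_congr_ae (Lp.coeFn_smul c f)).trans (condExp_smul c _ m) }
    1 fun f => by
      rw [one_mul]
      change ‖((Lp.memLp f).condExp (m := m) Fact.out).toLp (μ[f | m])‖ ≤ _
      rw [Lp.norm_toLp, Lp.norm_def]
      exact ENNReal.toReal_mono (Lp.eLpNorm_ne_top f) (eLpNorm_condExp_le_eLpNorm _ Fact.out)

theorem norm_condExpLp_le : ‖condExpLp p m μ‖ ≤ 1 :=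
  LinearMap.mkContinuous_norm_le _ zero_le_one _

theorem condExpLp_apply (f : Lp ℂ p μ) :
    condExpLp p m μ f = ((Lp.memLp f).condExp (m := m) Fact.out).toLp (μ[f | m]) := rfl

theorem condExpLp_toLp_of_stronglyMeasurable (hm : m ≤ m0) {f : α → ℂ}
    (hf : StronglyMeasurable[m] f) (hfp : MemLp f p μ) :
    condExpLp p m μ (hfp.toLp f) = hfp.toLp f := by
  rw [condExpLp_apply, MemLp.toLp_eq_toLp_iff]
  refine (condExp_congr_ae hfp.coeFn_toLp).trans ?_
  rw [condExp_of_stronglyMeasurable hm hf (hfp.integrable Fact.out)]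

omit [Fact (1 ≤ p)] in
theorem memLp_comp_of_finite {κ : Type*} [Finite κ] [MeasurableSpace κ] [DiscreteMeasurableSpace κ]
    {S : α → κ} (hS : Measurable S) (g : κ → ℂ) : MemLp (fun a => g (S a)) p μ := by
  obtain ⟨C, hC⟩ := (Set.finite_range fun k => ‖g k‖).bddAbove
  exact MemLp.of_bound ((measurable_of_finite g).comp hS).aestronglyMeasurable C
    (Eventually.of_forall fun a => hC ⟨S a, rfl⟩)

/-- A function measurable for the σ-algebra of `S` factors through the finite set `κ`, so the range
lies in the image of `κ → ℂ`. -/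
theorem finiteDimensional_range_condExpLp_comap {κ : Type*} [Finite κ] [MeasurableSpace κ]
    [DiscreteMeasurableSpace κ] {S : α → κ} (hS : Measurable S) :
    FiniteDimensional ℂ (condExpLp p (MeasurableSpace.comap S ‹_›) μ).range := by
  let Φ : (κ → ℂ) →ₗ[ℂ] Lp ℂ p μ :=
    { toFun := fun g => (memLp_comp_of_finite hS g).toLp _
      map_add' := fun _ _ => rfl
      map_smul' := fun _ _ => rfl }
  have hle : (condExpLp p (MeasurableSpace.comap S ‹_›) μ).range ≤ LinearMap.range Φ := by
    rintro _ ⟨f, rfl⟩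
    obtain ⟨g, -, hg⟩ := (stronglyMeasurable_condExp (μ := μ) (f := (f : α → ℂ))
      (m := MeasurableSpace.comap S ‹_›)).exists_eq_measurable_comp
    refine ⟨g, ?_⟩
    change (memLp_comp_of_finite hS g).toLp _ = condExpLp p _ μ f
    rw [condExpLp_apply, MemLp.toLp_eq_toLp_iff, hg]
    rfl
  exact Submodule.finiteDimensional_of_le hle

/-- The map `S` collects the values of all the simple functions into one tuple, built one factor at
a time. -/
theorem exists_finite_comap_stronglyMeasurable {α : Type*} [MeasurableSpace α] (s : Finset (SimpleFunc α ℂ)) :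
    ∃ (κ : Type) (_ : Finite κ) (_ : MeasurableSpace κ) (_ : DiscreteMeasurableSpace κ)
      (S : α → κ), Measurable S ∧
        ∀ f ∈ s, StronglyMeasurable[MeasurableSpace.comap S ‹_›] f := by
  classical
  induction s using Finset.induction with
  | empty => exact ⟨Unit, inferInstance, inferInstance, inferInstance, fun _ => (), by fun_prop,
      by simp⟩
  | insert f s hf ih =>
    obtain ⟨κ, _, _, _, S, hS, hs⟩ := ih
    have : Finite (Set.range f) := f.finite_range
    have hf' : Measurable (Set.rangeFactorization f) := f.measurable.subtype_mk
    refine ⟨κ × Set.range f, inferInstance, inferInstance, inferInstance,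
      fun a => (S a, Set.rangeFactorization f a), hS.prodMk hf', ?_⟩
    intro g hg
    have hm : Measurable[MeasurableSpace.comap
        (fun a => (S a, Set.rangeFactorization f a)) inferInstance]
        (fun a => (S a, Set.rangeFactorization f a)) := comap_measurable _
    rcases Finset.mem_insert.1 hg with rfl | hg
    · exact ((measurable_subtype_coe.comp measurable_snd).comp hm).stronglyMeasurable
    · refine (hs g hg).mono ?_
      rw [← measurable_iff_comap_le]
      exact measurable_fst.comp hm

/-- The net is indexed by finite sets of simple functions, so each simple function is eventually
fixed. Contractivity extends convergence to the closure, which is everything since `p ≠ ⊤`. No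
separability is needed. -/
theorem hasMetricApproximationProperty_Lp (hp : p ≠ ⊤) :
    HasMetricApproximationProperty (Lp ℂ p μ) := by
  classical
  choose κ h1 h2 h3 S hS hs using exists_finite_comap_stronglyMeasurable (α := α)
  let R : Finset (SimpleFunc α ℂ) → Lp ℂ p μ →L[ℂ] Lp ℂ p μ := fun s =>
    condExpLp p (MeasurableSpace.comap (S s) (h2 s)) μ
  have hR1 : ∀ s, ‖R s‖ ≤ 1 := fun s => norm_condExpLp_le
  refine ⟨map R atTop, inferInstance, eventually_map.2 (Eventually.of_forall hR1),
    eventually_map.2 (Eventually.of_forall fun s =>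
      finiteDimensional_range_condExpLp_comap (hS s)), fun y => tendsto_map'_iff.2 ?_⟩
  rw [Metric.tendsto_atTop]
  intro ε hε
  obtain ⟨g, hg⟩ := (Lp.simpleFunc.denseRange (E := ℂ) (μ := μ) hp).exists_dist_lt y (half_pos hε)
  refine ⟨{Lp.simpleFunc.toSimpleFunc g}, fun s hsg => ?_⟩
  have hgs := hs s _ (Finset.singleton_subset_iff.1 hsg)
  have hfix : R s (g : Lp ℂ p μ) = g := by
    have := condExpLp_toLp_of_stronglyMeasurable (p := p) (μ := μ) (hS s).comap_le hgs
      (Lp.simpleFunc.memLp g)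
    have h2 : (Lp.simpleFunc.memLp g).toLp _ = (g : Lp ℂ p μ) :=
      congrArg Subtype.val (Lp.simpleFunc.toLp_toSimpleFunc g)
    rwa [h2] at this
  calc dist (R s y) y ≤ dist (R s y) (R s g) + dist (R s g) y := dist_triangle _ _ _
    _ ≤ dist y g + dist (g : Lp ℂ p μ) y := by
          rw [hfix, dist_eq_norm, dist_eq_norm y]
          nth_rewrite 1 [← hfix]
          rw [← map_sub]
          gcongr
          simpa [dist_eq_norm] using ContinuousLinearMap.le_of_opNorm_le _ (hR1 s) (y - g)
    _ < ε := by rw [dist_comm _ y]; linarith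

end LpApproximation

/-! ### Schur's lemma and the orthogonality relations. -/

section Schur

open Matrix ComplexConjugate ComplexOrder

namespace UnitaryIrrep

variable {G : Type*} [Group G] [TopologicalSpace G]

theorem mat_mul (ξ : UnitaryIrrep G) (x y : G) : ξ.mat (x * y) = ξ.mat x * ξ.mat y := by
  simp [mat]

theorem mat_one (ξ : UnitaryIrrep G) : ξ.mat 1 = 1 := by
  simp [mat]

theorem conjTranspose_mat_mul_mat (ξ : UnitaryIrrep G) (x : G) : (ξ.mat x)ᴴ * ξ.mat x = 1 :=
  Matrix.mem_unitaryGroup_iff'.1 (ξ.toHom x).2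

theorem mat_mul_conjTranspose_mat (ξ : UnitaryIrrep G) (x : G) : ξ.mat x * (ξ.mat x)ᴴ = 1 :=
  Matrix.mem_unitaryGroup_iff.1 (ξ.toHom x).2

theorem mat_inv (ξ : UnitaryIrrep G) (x : G) : ξ.mat x⁻¹ = (ξ.mat x)ᴴ := by
  calc ξ.mat x⁻¹ = ξ.mat x⁻¹ * (ξ.mat x * (ξ.mat x)ᴴ) := by
        rw [ξ.mat_mul_conjTranspose_mat, Matrix.mul_one]
    _ = (ξ.mat x)ᴴ := by
        rw [← Matrix.mul_assoc, ← mat_mul, inv_mul_cancel, mat_one, Matrix.one_mul]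

theorem norm_mat_apply_le_one (ξ : UnitaryIrrep G) (x : G) (i j : Fin ξ.dim) :
    ‖ξ.mat x i j‖ ≤ 1 :=
  entry_norm_bound_of_unitary (ξ.toHom x).2 i j

theorem coeff_apply (ξ : UnitaryIrrep G) (i j : Fin ξ.dim) (x : G) :
    ξ.coeff i j x = ξ.mat x i j := rfl

theorem continuous_mat' (ξ : UnitaryIrrep G) : Continuous ξ.mat := ξ.continuous_mat

theorem dim_pos (ξ : UnitaryIrrep G) : 0 < ξ.dim := by
  by_contra h
  have h0 : ξ.dim = 0 := by omega
  have : IsEmpty (Fin ξ.dim) := by rw [h0]; infer_instance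
  have h2 := ξ.irreducible_rep
  apply bot_ne_top (α := Subrepresentation (matrixRepresentation ξ.toHom))
  apply Subrepresentation.toSubmodule_injective
  exact Subsingleton.elim _ _

theorem matrixRepresentation_apply (ξ : UnitaryIrrep G) (x : G) (v : Fin ξ.dim → ℂ) :
    matrixRepresentation ξ.toHom x v = ξ.mat x *ᵥ v := by
  simp [matrixRepresentation, mat]

/-- **Schur's lemma**: the commutant of an irreducible representation consists of scalars. -/
theorem exists_eq_smul_one_of_commute (ξ : UnitaryIrrep G) (P : Matrix (Fin ξ.dim) (Fin ξ.dim) ℂ)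
    (hP : ∀ x, ξ.mat x * P = P * ξ.mat x) : ∃ c : ℂ, P = c • 1 := by
  have := ξ.irreducible_rep
  let f : (matrixRepresentation ξ.toHom).IntertwiningMap (matrixRepresentation ξ.toHom) :=
    LinearMap.intertwiningMap_of_isIntertwiningMap _ _ (Matrix.toLin' P) fun g v => by
      simp only [matrixRepresentation_apply, Matrix.toLin'_apply, Matrix.mulVec_mulVec, hP]
  obtain ⟨c, hc⟩ :=
    Representation.IsIrreducible.algebraMap_intertwiningMap_bijective_of_isAlgClosed.2 f
  refine ⟨c, ?_⟩
  apply Matrix.toLin'.injective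
  ext1 v
  have h1 := congrArg (fun f => f.toLinearMap) hc
  have h2 : f.toLinearMap = Matrix.toLin' P := rfl
  rw [h2] at h1
  rw [← h1]
  simp [Algebra.algebraMap_eq_smul_one]
  rfl

/-- For an intertwiner `P ≠ 0`, both `Pᴴ P` and `P Pᴴ` are scalar. Computing `P Pᴴ P` in two ways
shows that the scalars agree. The common value is positive, so dividing `Pᴴ` by its square root
gives a unitary equivalence. -/
theorem eq_zero_of_not_equivalent {ξ η : UnitaryIrrep G} (h : ¬ Equivalent ξ η)
    (P : Matrix (Fin ξ.dim) (Fin η.dim) ℂ) (hP : ∀ x, ξ.mat x * P = P * η.mat x) : P = 0 := by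
  by_contra hP0
  apply h
  have hP' : ∀ x, η.mat x * Pᴴ = Pᴴ * ξ.mat x := fun x => by
    have := congrArg conjTranspose (hP x⁻¹)
    simpa [mat_inv, conjTranspose_mul] using this.symm
  obtain ⟨c, hc⟩ := η.exists_eq_smul_one_of_commute (Pᴴ * P) fun x => by
    rw [← Matrix.mul_assoc, hP', Matrix.mul_assoc, hP, Matrix.mul_assoc]
  obtain ⟨c', hc'⟩ := ξ.exists_eq_smul_one_of_commute (P * Pᴴ) fun x => by
    rw [← Matrix.mul_assoc, hP, Matrix.mul_assoc, hP', Matrix.mul_assoc]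
  have hcc : c = c' := by
    have h1 : P * Pᴴ * P = c • P := by rw [Matrix.mul_assoc, hc]; simp
    have h2 : P * Pᴴ * P = c' • P := by rw [hc']; simp
    have h3 : (c - c') • P = 0 := by rw [sub_smul, ← h1, ← h2, sub_self]
    exact sub_eq_zero.1 ((smul_eq_zero.1 h3).resolve_right hP0)
  subst hcc
  let i : Fin η.dim := ⟨0, η.dim_pos⟩
  have hci : c = ((∑ k, ‖P k i‖ ^ 2 : ℝ) : ℂ) := by
    have := congrFun (congrFun hc i) i
    simp only [Matrix.mul_apply, conjTranspose_apply, Matrix.smul_apply, Matrix.one_apply_eq,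
      smul_eq_mul, mul_one] at this
    rw [← this]
    push_cast
    refine Finset.sum_congr rfl fun k _ => ?_
    rw [← Complex.conj_mul']
    rfl
  set t : ℝ := ∑ k, ‖P k i‖ ^ 2
  have ht0 : 0 ≤ t := Finset.sum_nonneg fun k _ => by positivity
  have ht : t ≠ 0 := by
    intro ht
    rw [hci, ht] at hc
    simp only [Complex.ofReal_zero, zero_smul] at hc
    exact hP0 (Matrix.conjTranspose_mul_self_eq_zero.1 hc)
  have hstar : star ((√t : ℝ) : ℂ)⁻¹ = ((√t : ℝ) : ℂ)⁻¹ := by simp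
  have hs : ((√t : ℝ) : ℂ)⁻¹ * (((√t : ℝ) : ℂ)⁻¹ * c) = 1 := by
    rw [← mul_assoc, hci, ← mul_inv, ← Complex.ofReal_mul, Real.mul_self_sqrt ht0]
    exact inv_mul_cancel₀ (by exact_mod_cast ht)
  refine ⟨((√t : ℝ) : ℂ)⁻¹ • Pᴴ, ?_, ?_, fun x => ?_⟩
  · simp only [conjTranspose_smul, conjTranspose_conjTranspose, Matrix.smul_mul, Matrix.mul_smul,
      hc', smul_smul, hstar, hs, one_smul]
  · simp only [conjTranspose_smul, conjTranspose_conjTranspose, Matrix.smul_mul, Matrix.mul_smul,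
      hc, smul_smul, hstar, hs, one_smul]
  · rw [Matrix.smul_mul, Matrix.mul_smul, hP']

variable [IsTopologicalGroup G] [CompactSpace G] [MeasurableSpace G] [BorelSpace G]
  (μ : Measure G) [IsFiniteMeasure μ] [μ.IsMulLeftInvariant]

/-- The average of `ξ(x) B η(x)^*` over the group. -/
def averageMat (ξ η : UnitaryIrrep G) (B : Matrix (Fin ξ.dim) (Fin η.dim) ℂ) :
    Matrix (Fin ξ.dim) (Fin η.dim) ℂ :=
  Matrix.of fun i k => ∫ x, (ξ.mat x * B * (η.mat x)ᴴ) i k ∂μ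

omit [IsTopologicalGroup G] [μ.IsMulLeftInvariant] in
theorem integrable_averageMat (ξ η : UnitaryIrrep G) (B : Matrix (Fin ξ.dim) (Fin η.dim) ℂ)
    (i : Fin ξ.dim) (k : Fin η.dim) :
    Integrable (fun x => (ξ.mat x * B * (η.mat x)ᴴ) i k) μ :=
  Continuous.integrable_of_hasCompactSupport
    (((ξ.continuous_mat'.matrix_mul continuous_const).matrix_mul
      η.continuous_mat'.matrix_conjTranspose).matrix_elem i k)
    (HasCompactSupport.of_compactSpace _)

/-- By left invariance, replacing `x` by `g * x` leaves the average unchanged, while it conjugates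
the integrand by `ξ(g)` and `η(g)ᴴ`. -/
theorem mat_mul_averageMat (ξ η : UnitaryIrrep G) (B : Matrix (Fin ξ.dim) (Fin η.dim) ℂ) (g : G) :
    ξ.mat g * averageMat μ ξ η B = averageMat μ ξ η B * η.mat g := by
  suffices h : ξ.mat g * averageMat μ ξ η B * (η.mat g)ᴴ = averageMat μ ξ η B by
    rw [← h]
    nth_rewrite 2 [Matrix.mul_assoc]
    rw [conjTranspose_mat_mul_mat, Matrix.mul_one, h]
  ext i k
  have h1 : ∀ x, (ξ.mat (g * x) * B * (η.mat (g * x))ᴴ) i k =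
      ∑ b, (∑ a, ξ.mat g i a * (ξ.mat x * B * (η.mat x)ᴴ) a b) * (η.mat g)ᴴ b k := by
    intro x
    rw [mat_mul, mat_mul, conjTranspose_mul]
    have : ξ.mat g * ξ.mat x * B * ((η.mat x)ᴴ * (η.mat g)ᴴ) =
      ξ.mat g * (ξ.mat x * B * (η.mat x)ᴴ) * (η.mat g)ᴴ := by simp only [Matrix.mul_assoc]
    rw [this]
    simp only [Matrix.mul_apply (M := ξ.mat g * (ξ.mat x * B * (η.mat x)ᴴ)),
      Matrix.mul_apply (M := ξ.mat g)]
  have hI := integrable_averageMat μ ξ η B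
  calc (ξ.mat g * averageMat μ ξ η B * (η.mat g)ᴴ) i k
      = ∑ b, (∑ a, ξ.mat g i a * ∫ x, (ξ.mat x * B * (η.mat x)ᴴ) a b ∂μ) * (η.mat g)ᴴ b k := by
        simp only [Matrix.mul_apply (M := ξ.mat g * averageMat μ ξ η B),
          Matrix.mul_apply (M := ξ.mat g)]
        rfl
    _ = ∫ x, (ξ.mat (g * x) * B * (η.mat (g * x))ᴴ) i k ∂μ := by
        simp only [h1]
        rw [integral_finsetSum _ fun b _ => (integrable_finsetSum _ fun a _ =>
          (hI a b).const_mul _).mul_const _]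
        refine Finset.sum_congr rfl fun b _ => ?_
        rw [integral_mul_const, integral_finsetSum _ fun a _ => (hI a b).const_mul _]
        simp only [integral_const_mul]
    _ = averageMat μ ξ η B i k :=
        integral_mul_left_eq_self (fun x => (ξ.mat x * B * (η.mat x)ᴴ) i k) g

omit [IsTopologicalGroup G] [CompactSpace G] [BorelSpace G] [IsFiniteMeasure μ]
  [μ.IsMulLeftInvariant] in
theorem averageMat_single (ξ η : UnitaryIrrep G) (i j : Fin ξ.dim) (k l : Fin η.dim) :
    averageMat μ ξ η (Matrix.single j l 1) i k = ∫ x, ξ.mat x i j * conj (η.mat x k l) ∂μ := by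
  simp only [averageMat, Matrix.of_apply]
  refine integral_congr_ae (Filter.Eventually.of_forall fun x => ?_)
  simp [Matrix.mul_apply, Matrix.single_apply, ite_and]

theorem integral_mul_conj_of_not_equivalent {ξ η : UnitaryIrrep G} (h : ¬ Equivalent ξ η)
    (i j : Fin ξ.dim) (k l : Fin η.dim) : ∫ x, ξ.mat x i j * conj (η.mat x k l) ∂μ = 0 := by
  rw [← averageMat_single, eq_zero_of_not_equivalent h _ (mat_mul_averageMat μ ξ η _)]
  rfl

/-- The average of the elementary matrix at `(j, l)` is a scalar matrix. Averaging preserves the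
trace, so the scalar is `δ_jl / d`. -/
theorem integral_mul_conj_self [IsProbabilityMeasure μ] (ξ : UnitaryIrrep G)
    (i j k l : Fin ξ.dim) :
    ∫ x, ξ.mat x i j * conj (ξ.mat x k l) ∂μ = if i = k ∧ j = l then (ξ.dim : ℂ)⁻¹ else 0 := by
  obtain ⟨c, hc⟩ := ξ.exists_eq_smul_one_of_commute _
    (mat_mul_averageMat μ ξ ξ (Matrix.single j l 1))
  have hd : (ξ.dim : ℂ) ≠ 0 := Nat.cast_ne_zero.2 ξ.dim_pos.ne'
  have htr : (averageMat μ ξ ξ (Matrix.single j l 1)).trace = if j = l then 1 else 0 := by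
    calc (averageMat μ ξ ξ (Matrix.single j l 1)).trace
        = ∫ x, (ξ.mat x * Matrix.single j l 1 * (ξ.mat x)ᴴ).trace ∂μ := by
          simp only [Matrix.trace, Matrix.diag]
          rw [integral_finsetSum _ fun a _ => integrable_averageMat μ ξ ξ _ a a]
          rfl
      _ = if j = l then 1 else 0 := by
          have : ∀ x, (ξ.mat x * Matrix.single j l 1 * (ξ.mat x)ᴴ).trace =
              (if j = l then 1 else 0 : ℂ) := fun x => by
            rw [Matrix.trace_mul_comm, ← Matrix.mul_assoc, conjTranspose_mat_mul_mat,
              Matrix.one_mul]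
            split_ifs with h
            · subst h; simp
            · exact Matrix.trace_single_eq_of_ne _ _ _ h
          simp [this]
  have hc2 : c = if j = l then (ξ.dim : ℂ)⁻¹ else 0 := by
    rw [hc, Matrix.trace_smul, Matrix.trace_one, Fintype.card_fin, smul_eq_mul] at htr
    rw [eq_div_of_mul_eq hd htr]
    split_ifs <;> simp
  rw [← averageMat_single, hc, Matrix.smul_apply, Matrix.one_apply, hc2]
  split_ifs <;> simp_all

theorem integral_norm_coeff_sq [IsProbabilityMeasure μ] (ξ : UnitaryIrrep G) (i j : Fin ξ.dim) :
    ∫ x, ‖ξ.coeff i j x‖ ^ 2 ∂μ = (ξ.dim : ℝ)⁻¹ := by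
  have h := ξ.integral_mul_conj_self μ i j i j
  simp only [and_self, if_true, Complex.mul_conj'] at h
  simp only [coeff_apply]
  apply Complex.ofReal_injective
  rw [← integral_complex_ofReal]
  push_cast
  exact h

end UnitaryIrrep

end Schur

/-! ### Countability of the unitary dual. -/

section Countable

open ComplexConjugate

/-- Distinct vectors lie at distance `√2`, so the balls of radius `1/2` are disjoint open sets in a
separable space. -/
theorem Orthonormal.countable {ι E : Type*} [NormedAddCommGroup E] [InnerProductSpace ℂ E]
    [TopologicalSpace.SeparableSpace E] {v : ι → E} (hv : Orthonormal ℂ v) : Countable ι := by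
  rw [← Set.countable_univ_iff]
  refine Set.PairwiseDisjoint.countable_of_isOpen (s := fun i => Metric.ball (v i) (1 / 2))
    (fun i _ j _ hij => ?_) (fun i _ => Metric.isOpen_ball)
    (fun i _ => ⟨v i, Metric.mem_ball_self (by norm_num)⟩)
  refine Metric.ball_disjoint_ball ?_
  have h1 : ‖v i - v j‖ ^ 2 = 2 := by
    rw [@norm_sub_sq ℂ, hv.2 hij, hv.1, hv.1]
    norm_num
  rw [dist_eq_norm]
  nlinarith [norm_nonneg (v i - v j)]

variable {G : Type*} [Group G] [TopologicalSpace G] [IsTopologicalGroup G] [CompactSpace G]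
  [SecondCountableTopology G]

/-- One coefficient per class, scaled by `√d`, gives an orthonormal family in the separable space
`L²`. -/
theorem UnitaryDual.countable [MeasurableSpace G] [BorelSpace G] (μ : Measure G)
    [IsProbabilityMeasure μ] [μ.IsMulLeftInvariant] : Countable (UnitaryDual G) := by
  let rep : UnitaryDual G → UnitaryIrrep G := Quotient.out
  have hne : ∀ {c c'}, c ≠ c' → ¬ UnitaryIrrep.Equivalent (rep c) (rep c') := by
    intro c c' hcc h
    apply hcc
    rw [← Quotient.out_eq c, ← Quotient.out_eq c']
    exact Quotient.sound h
  let z : ∀ c, Fin (rep c).dim := fun c => ⟨0, (rep c).dim_pos⟩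
  let v : UnitaryDual G → Lp ℂ 2 μ := fun c =>
    ContinuousMap.toLp 2 μ ℂ (((√(rep c).dim : ℝ) : ℂ) • (rep c).coeff (z c) (z c))
  have hv : Orthonormal ℂ v := by
    classical
    rw [orthonormal_iff_ite]
    intro c c'
    rw [ContinuousMap.inner_toLp]
    have : ∀ x, (((√(rep c').dim : ℝ) : ℂ) • (rep c').coeff (z c') (z c')) x *
        conj ((((√(rep c).dim : ℝ) : ℂ) • (rep c).coeff (z c) (z c)) x) =
        ((√(rep c').dim : ℝ) : ℂ) * ((√(rep c).dim : ℝ) : ℂ) *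
        ((rep c').mat x (z c') (z c') * conj ((rep c).mat x (z c) (z c))) := fun x => by
      simp only [ContinuousMap.smul_apply, smul_eq_mul, map_mul, Complex.conj_ofReal,
        UnitaryIrrep.coeff_apply]
      ring
    simp only [this]
    rw [integral_const_mul]
    split_ifs with h
    · subst h
      have hd : ((rep c).dim : ℂ) ≠ 0 := Nat.cast_ne_zero.2 (rep c).dim_pos.ne'
      rw [UnitaryIrrep.integral_mul_conj_self, if_pos ⟨rfl, rfl⟩, ← Complex.ofReal_mul,
        Real.mul_self_sqrt (Nat.cast_nonneg _), Complex.ofReal_natCast, mul_inv_cancel₀ hd]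
    · rw [UnitaryIrrep.integral_mul_conj_of_not_equivalent μ (hne (Ne.symm h)), mul_zero]
  have : Fact ((2 : ℝ≥0∞) ≠ ⊤) := ⟨by simp⟩
  exact hv.countable

end Countable

/-! ### Coefficients of finite-dimensional unitary representations. -/

section FiniteDimensionalRepresentations

open ComplexConjugate

variable (G : Type*) [Group G] [TopologicalSpace G]

/-- The linear span of the matrix coefficients of the irreducible representations. -/
def coeffSpan : Submodule ℂ C(G, ℂ) :=
  Submodule.span ℂ {f | ∃ (ξ : UnitaryIrrep G) (i j : Fin ξ.dim), f = ξ.coeff i j}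

variable {G} {H : Type*} [NormedAddCommGroup H] [InnerProductSpace ℂ H]
  (ρ : G →* (H ≃ₗᵢ[ℂ] H)) (hρ : ∀ v, Continuous fun x => ρ x v)

/-- The matrix coefficient `x ↦ ⟪w, ρ(x) v⟫`. -/
def matrixCoeff (w v : H) : C(G, ℂ) where
  toFun x := inner ℂ w (ρ x v)
  continuous_toFun := continuous_const.inner (hρ v)

omit [TopologicalSpace G] in
theorem unitary_map_mul_apply (x y : G) (v : H) : ρ (x * y) v = ρ x (ρ y v) := by
  rw [map_mul]
  rfl

omit [TopologicalSpace G] in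
theorem unitary_map_apply_inv (x : G) (v : H) : ρ x (ρ x⁻¹ v) = v := by
  rw [← unitary_map_mul_apply, mul_inv_cancel, map_one]
  rfl

/-- In an orthonormal basis of `W` the action becomes a `UnitaryIrrep`, and the coefficient expands
in its entries. The vector `w` may lie outside `W`, since only its inner products with the basis
enter. -/
theorem matrixCoeff_mem_coeffSpan_of_irreducible (W : Submodule ℂ H) [FiniteDimensional ℂ W]
    (hW : ∀ x, ∀ v ∈ W, ρ x v ∈ W) (hW0 : W ≠ ⊥)
    (hirr : ∀ V ≤ W, (∀ x, ∀ v ∈ V, ρ x v ∈ V) → V = ⊥ ∨ V = W) {w v : H}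
    (hv : v ∈ W) : matrixCoeff ρ hρ w v ∈ coeffSpan G := by
  set d := Module.finrank ℂ W
  let b : OrthonormalBasis (Fin d) ℂ W := stdOrthonormalBasis ℂ W
  have hexp : ∀ u ∈ W, u = ∑ k, inner ℂ (b k : H) u • (b k : H) := fun u hu => by
    have := congrArg Subtype.val (b.sum_repr' ⟨u, hu⟩)
    rw [Submodule.coe_sum] at this
    simpa using this.symm
  have hbW : ∀ k, (b k : H) ∈ W := fun k => (b k).2
  have hort : ∀ i j, inner ℂ (b i : H) (b j : H) = if i = j then (1 : ℂ) else 0 := fun i j => by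
    rw [← Submodule.coe_inner]
    exact orthonormal_iff_ite.1 b.orthonormal i j
  have hinner : ∀ u u', u' ∈ W → inner ℂ u u' = ∑ k, inner ℂ u (b k : H) * inner ℂ (b k : H) u' :=
    fun u u' hu' => by
      conv_lhs => rw [hexp u' hu']
      simp [mul_comm]
  let M : G → Matrix (Fin d) (Fin d) ℂ := fun x => Matrix.of fun i j => inner ℂ (b i : H) (ρ x (b j))
  have hM1 : M 1 = 1 := by
    ext i j
    simp [M, hort, Matrix.one_apply]
  have hMmul : ∀ x y, M (x * y) = M x * M y := fun x y => by
    ext i j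
    simp only [M, Matrix.of_apply, Matrix.mul_apply, unitary_map_mul_apply]
    conv_lhs => rw [hexp _ (hW y _ (hbW j))]
    simp [mul_comm]
  have hMinv : ∀ x, M x⁻¹ = (M x)ᴴ := fun x => by
    ext i j
    simp only [M, Matrix.of_apply, Matrix.conjTranspose_apply]
    rw [← (ρ x).inner_map_map, unitary_map_apply_inv]
    exact (inner_conj_symm _ _).symm
  have hMu : ∀ x, M x ∈ Matrix.unitaryGroup (Fin d) ℂ := fun x => by
    rw [Matrix.mem_unitaryGroup_iff, Matrix.star_eq_conjTranspose, ← hMinv, ← hMmul,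
      mul_inv_cancel, hM1]
  let φ : G →* Matrix.unitaryGroup (Fin d) ℂ :=
    { toFun := fun x => ⟨M x, hMu x⟩
      map_one' := Subtype.ext hM1
      map_mul' := fun x y => Subtype.ext (hMmul x y) }
  have hφc : Continuous fun x => (φ x : Matrix (Fin d) (Fin d) ℂ) :=
    continuous_matrix fun i j => continuous_const.inner (hρ _)
  -- `Φ` is an equivariant injection with image `W`. It carries invariant subspaces of `ℂᵈ` to
  -- invariant subspaces of `W`, so irreducibility transfers.
  let Φ : (Fin d → ℂ) →ₗ[ℂ] H := Fintype.linearCombination ℂ fun k => (b k : H)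
  have hΦ : ∀ c, Φ c = ∑ k, c k • (b k : H) := fun c => rfl
  have hΦρ : ∀ x c, Φ (matrixRepresentation φ x c) = ρ x (Φ c) := fun x c => by
    have h1 : matrixRepresentation φ x c = M x *ᵥ c := by
      simp [matrixRepresentation, φ]
    rw [h1, hΦ, hΦ, map_sum]
    simp only [Matrix.mulVec, dotProduct, Finset.sum_smul, map_smul]
    rw [Finset.sum_comm]
    refine Finset.sum_congr rfl fun j _ => ?_
    conv_rhs => rw [hexp _ (hW x _ (hbW j)), Finset.smul_sum]
    simp [M, smul_smul, mul_comm]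
  have hΦinj : Function.Injective Φ := by
    have hli : LinearIndependent ℂ fun k => (b k : H) := by
      simpa using! b.toBasis.linearIndependent.map' W.subtype (Submodule.ker_subtype W)
    exact hli.fintypeLinearCombination_injective
  have hΦW : Submodule.map Φ ⊤ = W := by
    apply le_antisymm
    · rintro _ ⟨c, -, rfl⟩
      rw [hΦ]
      exact W.sum_mem fun k _ => W.smul_mem _ (hbW k)
    · intro u hu
      exact ⟨fun k => inner ℂ (b k : H) u, trivial, (hexp u hu).symm⟩
  have hdpos : 0 < d := by
    rw [Module.finrank_pos_iff]
    exact Submodule.nontrivial_iff_ne_bot.2 hW0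
  have hirr' : (matrixRepresentation φ).IsIrreducible :=
    { exists_pair_ne := ⟨⊥, ⊤, fun h => by
        have h2 : (⊥ : Submodule ℂ (Fin d → ℂ)) = ⊤ :=
          congrArg Subrepresentation.toSubmodule h
        have : Nonempty (Fin d) := ⟨⟨0, hdpos⟩⟩
        exact bot_ne_top h2⟩
      eq_bot_or_eq_top := fun V => by
        have hinv : ∀ x, ∀ v ∈ V.toSubmodule.map Φ, ρ x v ∈ V.toSubmodule.map Φ := by
          rintro x _ ⟨c, hc, rfl⟩
          exact ⟨_, V.apply_mem_toSubmodule x hc, hΦρ x c⟩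
        refine (hirr (V.toSubmodule.map Φ) (hΦW ▸ Submodule.map_mono le_top) hinv).imp
          (fun h => ?_) fun h => ?_
        · apply Subrepresentation.toSubmodule_injective
          exact (Submodule.map_injective_of_injective hΦinj) (h.trans (Submodule.map_bot Φ).symm)
        · apply Subrepresentation.toSubmodule_injective
          exact (Submodule.map_injective_of_injective hΦinj) (h.trans hΦW.symm) }
  let ξ : UnitaryIrrep G := ⟨d, φ, hφc, hirr'⟩
  have hsum : matrixCoeff ρ hρ w v =
      ∑ i, ∑ j, (inner ℂ w (b i : H) * inner ℂ (b j : H) v) • ξ.coeff i j := by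
    ext x
    simp only [ContinuousMap.coe_sum, ContinuousMap.coe_smul, Finset.sum_apply, Pi.smul_apply,
      smul_eq_mul]
    change inner ℂ w (ρ x v) = ∑ i, ∑ j, (inner ℂ w (b i : H) * inner ℂ (b j : H) v) *
      inner ℂ (b i : H) (ρ x (b j))
    rw [hinner w _ (hW x v hv)]
    refine Finset.sum_congr rfl fun i _ => ?_
    conv_lhs => rw [hexp v hv]
    simp only [map_sum, map_smul, inner_sum, inner_smul_right, Finset.mul_sum]
    exact Finset.sum_congr rfl fun j _ => by ring
  rw [hsum]
  exact Submodule.sum_mem _ fun i _ => Submodule.sum_mem _ fun j _ => Submodule.smul_mem _ _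
    (Submodule.subset_span ⟨ξ, i, j, rfl⟩)

omit [TopologicalSpace G] in
theorem map_mem_orthogonal_of_invariant {W : Submodule ℂ H} (hW : ∀ x, ∀ v ∈ W, ρ x v ∈ W) (x : G)
    {v : H} (hv : v ∈ Wᗮ) : ρ x v ∈ Wᗮ := by
  intro u hu
  have := hv _ (hW x⁻¹ u hu)
  rwa [← (ρ x).inner_map_map, unitary_map_apply_inv] at this

theorem matrixCoeff_add_add {w w' v v' : H} (h1 : ∀ x, inner ℂ w (ρ x v') = 0)
    (h2 : ∀ x, inner ℂ w' (ρ x v) = 0) :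
    matrixCoeff ρ hρ (w + w') (v + v') = matrixCoeff ρ hρ w v + matrixCoeff ρ hρ w' v' := by
  ext x
  simp [matrixCoeff, h1, h2]

/-- Matrix coefficients of a finite-dimensional unitary representation are linear combinations
of matrix coefficients of irreducible ones. -/
theorem matrixCoeff_mem_coeffSpan (W : Submodule ℂ H) [FiniteDimensional ℂ W]
    (hW : ∀ x, ∀ v ∈ W, ρ x v ∈ W) {w v : H} (hw : w ∈ W) (hv : v ∈ W) :
    matrixCoeff ρ hρ w v ∈ coeffSpan G := by
  induction hn : Module.finrank ℂ W using Nat.strong_induction_on generalizing W w v with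
  | _ n ih =>
  by_cases hW0 : W = ⊥
  · subst hW0
    rw [(Submodule.mem_bot ℂ).1 hw]
    convert (coeffSpan G).zero_mem
    ext x
    simp [matrixCoeff]
  by_cases hirr : ∀ V ≤ W, (∀ x, ∀ v ∈ V, ρ x v ∈ V) → V = ⊥ ∨ V = W
  · exact matrixCoeff_mem_coeffSpan_of_irreducible ρ hρ W hW hW0 hirr hv
  -- A proper nonzero invariant `V` splits `W` into `V` and `Vᗮ ⊓ W`, both invariant and of smaller
  -- dimension. Mixed coefficients vanish by orthogonality, leaving two cases of the induction
  -- hypothesis.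
  push Not at hirr
  obtain ⟨V, hVW, hV, hV0, hVne⟩ := hirr
  have : FiniteDimensional ℂ V := Submodule.finiteDimensional_of_le hVW
  have hlt : V < W := lt_of_le_of_ne hVW hVne
  have hlt' : Vᗮ ⊓ W < W := by
    refine lt_of_le_of_ne inf_le_right fun h => hV0 ?_
    rw [eq_bot_iff]
    intro u hu
    have : u ∈ Vᗮ := (h.symm ▸ hVW hu : u ∈ Vᗮ ⊓ W).1
    exact (Submodule.mem_bot ℂ).2 (inner_self_eq_zero.1 (this u hu))
  have hV' : ∀ x, ∀ v ∈ Vᗮ ⊓ W, ρ x v ∈ Vᗮ ⊓ W := fun x v hv =>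
    ⟨map_mem_orthogonal_of_invariant ρ hV x hv.1, hW x v hv.2⟩
  have hdec : ∀ u ∈ W, ∃ a ∈ V, ∃ c ∈ Vᗮ ⊓ W, u = a + c := fun u hu => by
    obtain ⟨a, ha, c, hc, rfl⟩ := V.exists_add_mem_mem_orthogonal u
    exact ⟨a, ha, c, ⟨hc, by simpa using W.sub_mem hu (hVW ha)⟩, rfl⟩
  obtain ⟨a, ha, c, hc, rfl⟩ := hdec w hw
  obtain ⟨a', ha', c', hc', rfl⟩ := hdec v hv
  rw [matrixCoeff_add_add ρ hρ (fun x => (hV' x _ hc').1 _ ha) fun x =>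
    inner_eq_zero_symm.1 (hc.1 _ (hV x _ ha'))]
  have : FiniteDimensional ℂ (Vᗮ ⊓ W : Submodule ℂ H) := Submodule.finiteDimensional_of_le hlt'.le
  exact (coeffSpan G).add_mem
    (ih _ (hn ▸ Submodule.finrank_lt_finrank_of_lt hlt) V hV ha ha' rfl)
    (ih _ (hn ▸ Submodule.finrank_lt_finrank_of_lt hlt') _ hV' hc hc' rfl)

end FiniteDimensionalRepresentations

/-! ### The Peter–Weyl theorem via compact convolution operators. -/

section PeterWeyl

open Filter Topology ComplexConjugate

variable {G : Type*} [Group G] [TopologicalSpace G] [IsTopologicalGroup G] [CompactSpace G]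
  [MeasurableSpace G] [BorelSpace G]
  (μ : Measure G) [IsFiniteMeasure μ] [μ.IsMulLeftInvariant]

/-- The left regular representation on `L²`. -/
def leftRegular : G →* (Lp ℂ 2 μ ≃ₗᵢ[ℂ] Lp ℂ 2 μ) where
  toFun x :=
    { toFun := fun f => DomMulAct.mk x⁻¹ • f
      invFun := fun f => DomMulAct.mk x • f
      map_add' := fun f g => smul_add _ _ _
      map_smul' := fun c f => smul_comm _ _ _
      left_inv := fun f => by simp [smul_smul]
      right_inv := fun f => by simp [smul_smul]
      norm_map' := fun f => DomMulAct.norm_smul_Lp _ f }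
  map_one' := by ext1 f; simp
  map_mul' x y := by
    ext1 f
    change DomMulAct.mk (x * y)⁻¹ • f = DomMulAct.mk x⁻¹ • DomMulAct.mk y⁻¹ • f
    rw [smul_smul, ← DomMulAct.mk_mul, mul_inv_rev]

omit [CompactSpace G] in
theorem continuous_leftRegular [μ.InnerRegularCompactLTTop] (f : Lp ℂ 2 μ) :
    Continuous fun x => leftRegular μ x f := by
  have : Fact ((2 : ℝ≥0∞) ≠ ⊤) := ⟨by simp⟩
  have h : Continuous fun x : G => DomMulAct.mk x⁻¹ • f :=
    (DomMulAct.continuous_mk.comp continuous_inv).smul continuous_const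
  exact h

theorem leftRegular_toLp (x : G) (f : C(G, ℂ)) :
    leftRegular μ x (ContinuousMap.toLp 2 μ ℂ f) =
      ContinuousMap.toLp 2 μ ℂ (f.comp ⟨fun y => x⁻¹ * y, by fun_prop⟩) :=
  rfl

variable [μ.InnerRegularCompactLTTop]

/-- The convolution type operator `f ↦ (x ↦ ⟪ρ(x) h, f⟫)` where `ρ` is the left regular
representation. -/
def convOp (h : Lp ℂ 2 μ) : Lp ℂ 2 μ →L[ℂ] C(G, ℂ) :=
  LinearMap.mkContinuous
    { toFun := fun f => ⟨fun x => inner ℂ (leftRegular μ x h) f,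
        (continuous_leftRegular μ h).inner continuous_const⟩
      map_add' := fun f g => by ext x; simp [inner_add_right]
      map_smul' := fun c f => by ext x; simp [inner_smul_right] }
    ‖h‖ fun f => by
      rw [ContinuousMap.norm_le _ (by positivity)]
      intro x
      simpa using norm_inner_le_norm (𝕜 := ℂ) (leftRegular μ x h) f

theorem convOp_apply (h f : Lp ℂ 2 μ) (x : G) :
    convOp μ h f x = inner ℂ (leftRegular μ x h) f := rfl

/-- Arzelà–Ascoli: on the unit ball, values at `x` and `x₀` differ by at most `‖ρ(x)h - ρ(x₀)h‖`, so
strong continuity of the regular representation yields equicontinuity. -/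
theorem isCompactOperator_convOp (h : Lp ℂ 2 μ) : IsCompactOperator (convOp μ h) := by
  let e := ContinuousMap.linearIsometryBoundedOfCompact G ℂ ℂ
  let A : Set (BoundedContinuousFunction G ℂ) :=
    (fun f => e (convOp μ h f)) '' Metric.ball 0 1
  have hA : IsCompact (closure A) := by
    refine BoundedContinuousFunction.arzela_ascoli (Metric.closedBall (0 : ℂ) ‖h‖)
      (isCompact_closedBall _ _) A ?_ ?_
    · rintro _ x ⟨f, hf, rfl⟩
      rw [mem_closedBall_zero_iff]
      change ‖inner ℂ (leftRegular μ x h) f‖ ≤ _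
      refine (norm_inner_le_norm _ _).trans ?_
      rw [mem_ball_zero_iff] at hf
      simpa using mul_le_mul_of_nonneg_left hf.le (norm_nonneg h)
    · intro x₀
      rw [Metric.equicontinuousAt_iff_right]
      intro ε hε
      filter_upwards [Metric.tendsto_nhds.1 ((continuous_leftRegular μ h).tendsto x₀) ε hε]
      rintro x hx ⟨_, f, hf, rfl⟩
      change dist (inner ℂ (leftRegular μ x₀ h) f) (inner ℂ (leftRegular μ x h) f) < ε
      rw [dist_comm, dist_eq_norm, ← inner_sub_left]
      refine (norm_inner_le_norm _ _).trans_lt ?_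
      rw [← dist_eq_norm]
      rw [mem_ball_zero_iff] at hf
      exact (mul_le_of_le_one_right dist_nonneg hf.le).trans_lt hx
  have := isCompactOperator_iff_image_ball_subset_compact (convOp μ h).toLinearMap one_pos
  refine this.2 ⟨e.symm '' closure A, hA.image e.symm.continuous, ?_⟩
  rintro _ ⟨f, hf, rfl⟩
  exact ⟨e (convOp μ h f), subset_closure ⟨f, hf, rfl⟩, e.symm_apply_apply _⟩

/-- `convOp` as an operator on `L²`. -/
def convOpLp (h : Lp ℂ 2 μ) : Lp ℂ 2 μ →L[ℂ] Lp ℂ 2 μ :=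
  (ContinuousMap.toLp 2 μ ℂ).comp (convOp μ h)

theorem isCompactOperator_convOpLp (h : Lp ℂ 2 μ) : IsCompactOperator (convOpLp μ h) :=
  (isCompactOperator_convOp μ h).clm_comp (ContinuousMap.toLp 2 μ ℂ)

theorem convOpLp_leftRegular (h f : Lp ℂ 2 μ) (x : G) :
    convOpLp μ h (leftRegular μ x f) = leftRegular μ x (convOpLp μ h f) := by
  change ContinuousMap.toLp 2 μ ℂ _ = leftRegular μ x (ContinuousMap.toLp 2 μ ℂ _)
  rw [leftRegular_toLp]
  congr 1
  ext y
  change inner ℂ (leftRegular μ y h) (leftRegular μ x f) = inner ℂ (leftRegular μ (x⁻¹ * y) h) f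
  rw [← (leftRegular μ x).inner_map_map (leftRegular μ (x⁻¹ * y) h), ← unitary_map_mul_apply,
    mul_inv_cancel_left]

theorem convOp_toLp_apply (k f : C(G, ℂ)) (hk : ∀ x, conj (k x) = k x) (x : G) :
    convOp μ (ContinuousMap.toLp 2 μ ℂ k) (ContinuousMap.toLp 2 μ ℂ f) x =
      ∫ y, f y * k (x⁻¹ * y) ∂μ := by
  rw [convOp_apply, leftRegular_toLp, ContinuousMap.inner_toLp]
  simp [hk]

/-- The kernel `k(x⁻¹y)` is real and symmetric in `x, y`. Fubini proves the claim for continuous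
functions, and density extends it. -/
theorem isSymmetric_convOpLp (k : C(G, ℂ)) (hk : ∀ x, conj (k x) = k x)
    (hinv : ∀ x, k x⁻¹ = k x) :
    (convOpLp μ (ContinuousMap.toLp 2 μ ℂ k)).IsSymmetric := by
  intro f g
  have hd : DenseRange (ContinuousMap.toLp (E := ℂ) 2 μ ℂ) :=
    ContinuousMap.toLp_denseRange ℂ μ ℂ (by simp)
  refine DenseRange.induction_on₂ (p := fun f g =>
    inner ℂ (convOpLp μ (ContinuousMap.toLp 2 μ ℂ k) f) g =
      inner ℂ f (convOpLp μ (ContinuousMap.toLp 2 μ ℂ k) g)) hd ?_ (fun f g => ?_) f g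
  · exact isClosed_eq (by fun_prop) (by fun_prop)
  · simp only [convOpLp, ContinuousLinearMap.comp_apply]
    rw [ContinuousMap.inner_toLp, ContinuousMap.inner_toLp]
    simp only [convOp_toLp_apply μ k _ hk]
    calc ∫ x, g x * conj (∫ y, f y * k (x⁻¹ * y) ∂μ) ∂μ
        = ∫ x, ∫ y, g x * (conj (f y) * k (x⁻¹ * y)) ∂μ ∂μ := by
          simp only [← integral_conj, map_mul, hk, integral_const_mul]
      _ = ∫ y, ∫ x, g x * (conj (f y) * k (x⁻¹ * y)) ∂μ ∂μ := by
          apply integral_integral_swap_of_hasCompactSupport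
          · have : Continuous fun z : G × G => g z.1 * (conj (f z.2) * k (z.1⁻¹ * z.2)) := by
              fun_prop
            exact this
          · exact HasCompactSupport.of_compactSpace _
      _ = ∫ y, (∫ x, g x * k (y⁻¹ * x) ∂μ) * conj (f y) ∂μ := by
          congr 1
          ext y
          rw [← integral_mul_const]
          congr 1
          ext x
          rw [← hinv (x⁻¹ * y), mul_inv_rev, inv_inv]
          ring

/-- The eigenspace is finite-dimensional by compactness and invariant under translation. Only the
component of `h` in it contributes. The conjugate appears because `ρ(x)h` sits in the
conjugate-linear slot of the inner product. -/
theorem star_convOp_mem_coeffSpan_of_eigenvector {h : Lp ℂ 2 μ} {c : ℂ} (hc : c ≠ 0)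
    {f : Lp ℂ 2 μ} (hf : convOpLp μ h f = c • f) : star (convOp μ h f) ∈ coeffSpan G := by
  let W := Module.End.eigenspace (convOpLp μ h).toLinearMap c
  have hfW : f ∈ W := Module.End.mem_eigenspace_iff.2 hf
  have hcpt : IsCompactOperator (convOpLp μ h) := isCompactOperator_convOpLp μ h
  have : FiniteDimensional ℂ W := ContinuousLinearMap.finite_dimensional_eigenspace hcpt c hc
  have hW : ∀ x, ∀ v ∈ W, leftRegular μ x v ∈ W := fun x v hv => by
    rw [Module.End.mem_eigenspace_iff] at hv ⊢
    change convOpLp μ h _ = _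
    rw [convOpLp_leftRegular]
    change leftRegular μ x ((convOpLp μ h).toLinearMap v) = _
    rw [hv, map_smul]
  obtain ⟨a, ha, b, hb, rfl⟩ := W.exists_add_mem_mem_orthogonal h
  have : star (convOp μ (a + b) f) =
      matrixCoeff (leftRegular μ) (continuous_leftRegular μ) f a := by
    ext x
    change conj (inner ℂ (leftRegular μ x (a + b)) f) = inner ℂ f (leftRegular μ x a)
    rw [inner_conj_symm, map_add, inner_add_right,
      map_mem_orthogonal_of_invariant (leftRegular μ) hW x hb f hfW, add_zero]
  rw [this]
  exact matrixCoeff_mem_coeffSpan _ _ W hW hfW ha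

/-- By the spectral theorem for compact symmetric operators the eigenspaces span a dense subspace,
and the condition on `f` is closed and linear. -/
theorem star_convOp_mem_closure_coeffSpan [μ.IsOpenPosMeasure] (k : C(G, ℂ))
    (hk : ∀ x, conj (k x) = k x)
    (hinv : ∀ x, k x⁻¹ = k x) (f : Lp ℂ 2 μ) :
    star (convOp μ (ContinuousMap.toLp 2 μ ℂ k) f) ∈ (coeffSpan G).topologicalClosure := by
  set h := ContinuousMap.toLp 2 μ ℂ k
  let N : Submodule ℂ (Lp ℂ 2 μ) :=
    { carrier := {f | star (convOp μ h f) ∈ (coeffSpan G).topologicalClosure}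
      zero_mem' := by simp
      add_mem' := fun {a b} ha hb => by
        simpa using Submodule.add_mem _ ha hb
      smul_mem' := fun c a ha => by
        simpa using Submodule.smul_mem _ (conj c) ha }
  have hN : IsClosed (N : Set (Lp ℂ 2 μ)) :=
    (coeffSpan G).isClosed_topologicalClosure.preimage
      (continuous_star.comp (convOp μ h).continuous)
  have hcpt : IsCompactOperator (convOpLp μ h) := isCompactOperator_convOpLp μ h
  have hbot := ContinuousLinearMap.orthogonalComplement_iSup_eigenspaces_eq_bot hcpt
    (isSymmetric_convOpLp μ k hk hinv)
  have hle : (⨆ c, Module.End.eigenspace (convOpLp μ h).toLinearMap c) ≤ N := by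
    refine iSup_le fun c f hf => ?_
    have hf' : convOpLp μ h f = c • f := Module.End.mem_eigenspace_iff.1 hf
    change star (convOp μ h f) ∈ (coeffSpan G).topologicalClosure
    -- The kernel may be infinite-dimensional, but there the continuous function `convOp μ h f`
    -- vanishes, because `toLp` is injective.
    by_cases hc : c = 0
    · rw [hc, zero_smul] at hf'
      have h0 : convOp μ h f = 0 :=
        ContinuousMap.toLp_injective (p := 2) (𝕜 := ℂ) μ (hf'.trans (map_zero _).symm)
      rw [h0]
      simp
    · exact Submodule.le_topologicalClosure _
        (star_convOp_mem_coeffSpan_of_eigenvector μ hc hf')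
  have htop := Submodule.topologicalClosure_minimal _ hle hN
  rw [Submodule.topologicalClosure_eq_top_iff.2 hbot] at htop
  exact htop (Submodule.mem_top (x := f))

-- Currying makes `u ↦ f(· * u)` continuous into `C(G)` with the sup norm, which gives uniformity in
-- `x`.
omit [MeasurableSpace G] [BorelSpace G] in
theorem exists_nhds_one_norm_mul_sub_le (f : C(G, ℂ)) {ε : ℝ} (hε : 0 < ε) :
    ∃ U ∈ 𝓝 (1 : G), ∀ u ∈ U, ∀ x, ‖f (x * u) - f x‖ ≤ ε := by
  let F : C(G, C(G, ℂ)) := ContinuousMap.curry ⟨fun z : G × G => f (z.2 * z.1), by fun_prop⟩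
  have hF := F.continuous.tendsto 1
  rw [Metric.tendsto_nhds] at hF
  refine ⟨_, hF ε hε, fun u hu x => ?_⟩
  have h2 : dist (F u) (F 1) < ε := hu
  rw [dist_eq_norm] at h2
  have h1 := (ContinuousMap.norm_coe_le_norm (F u - F 1) x).trans h2.le
  have h3 : (F u - F 1) x = f (x * u) - f (x * 1) := rfl
  rwa [h3, mul_one] at h1

omit [μ.InnerRegularCompactLTTop] [μ.IsMulLeftInvariant] in
theorem exists_symmetric_bump [μ.IsOpenPosMeasure] {U : Set G} (hU : U ∈ 𝓝 (1 : G)) :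
    ∃ k : C(G, ℝ), (∀ x, 0 ≤ k x) ∧ (∀ x, k x⁻¹ = k x) ∧ (∀ x, x ∉ U → k x = 0) ∧
      ∫ x, k x ∂μ = 1 := by
  obtain ⟨φ, hφ1, hφ0, hφ⟩ := exists_continuous_one_zero_of_isCompact
    (isCompact_singleton (x := (1 : G))) (isOpen_interior (s := U)).isClosed_compl
    (by simpa [Set.disjoint_singleton_left] using mem_interior_iff_mem_nhds.2 hU)
  -- The product with the inverted function is symmetric and still vanishes off `U`.
  let k₀ : C(G, ℝ) := ⟨fun x => φ x * φ x⁻¹, by fun_prop⟩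
  have h0 : ∀ x, 0 ≤ k₀ x := fun x => mul_nonneg (hφ.2 x).1 (hφ.2 x⁻¹).1
  have h1 : k₀ 1 ≠ 0 := by
    have : φ 1 = 1 := hφ1 (Set.mem_singleton 1)
    simp [k₀, this]
  have hpos : 0 < ∫ x, k₀ x ∂μ :=
    k₀.continuous.integral_pos_of_hasCompactSupport_nonneg_nonzero
      (HasCompactSupport.of_compactSpace _) h0 h1
  refine ⟨(∫ x, k₀ x ∂μ)⁻¹ • k₀, fun x => ?_, fun x => ?_, fun x hx => ?_, ?_⟩
  · have := h0 x
    simp only [ContinuousMap.smul_apply, smul_eq_mul]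
    positivity
  · simp [k₀, mul_comm]
  · have : φ x = 0 := hφ0 fun hx' => hx (interior_subset hx')
    simp [k₀, this]
  · simp only [ContinuousMap.smul_apply, smul_eq_mul]
    rw [integral_const_mul, inv_mul_cancel₀ hpos.ne']

/-- The **Peter–Weyl theorem**: the matrix coefficients of the irreducible representations span
a dense subspace of `C(G)`. -/
theorem topologicalClosure_coeffSpan_eq_top [μ.IsOpenPosMeasure] :
    (coeffSpan G).topologicalClosure = ⊤ := by
  rw [eq_top_iff]
  intro g _
  -- Approximation by elements of the closure suffices. These are conjugates of convolutions of
  -- `star g` with a bump near `1`, acting as an approximate identity.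
  rw [← SetLike.mem_coe, Submodule.topologicalClosure_coe, ← closure_closure, Metric.mem_closure_iff]
  intro ε hε
  let f : C(G, ℂ) := star g
  obtain ⟨U, hU, hUf⟩ := exists_nhds_one_norm_mul_sub_le f (half_pos hε)
  obtain ⟨k, hk0, hkinv, hkU, hkint⟩ := exists_symmetric_bump μ hU
  let k' : C(G, ℂ) := ⟨fun x => (k x : ℂ), by fun_prop⟩
  have hmem := star_convOp_mem_closure_coeffSpan μ k' (fun x => Complex.conj_ofReal _)
    (fun x => congrArg Complex.ofReal (hkinv x)) (ContinuousMap.toLp 2 μ ℂ f)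
  refine ⟨_, hmem, ?_⟩
  rw [dist_comm, dist_eq_norm, ← norm_star, star_sub, star_star]
  refine lt_of_le_of_lt ?_ (half_lt_self hε)
  rw [ContinuousMap.norm_le _ (half_pos hε).le]
  intro x
  rw [ContinuousMap.sub_apply, convOp_toLp_apply μ k' f (fun x => Complex.conj_ofReal _)]
  have hI : ∀ {φ : G → ℂ}, Continuous φ → Integrable φ μ := fun hφ =>
    hφ.integrable_of_hasCompactSupport (HasCompactSupport.of_compactSpace _)
  have e1 : ∫ y, f y * k' (x⁻¹ * y) ∂μ = ∫ y, f (x * y) * k' y ∂μ := by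
    rw [← integral_mul_left_eq_self _ x]
    simp
  have e2 : f x = ∫ y, f x * k' y ∂μ := by
    rw [integral_const_mul]
    change _ = f x * ∫ y, (k y : ℂ) ∂μ
    rw [integral_complex_ofReal, hkint]
    simp
  change ‖_ - f x‖ ≤ _
  rw [e1, e2, ← integral_sub (hI (by fun_prop)) (hI (by fun_prop))]
  calc ‖∫ y, f (x * y) * k' y - f x * k' y ∂μ‖ ≤ ∫ y, ε / 2 * k y ∂μ := by
        refine norm_integral_le_of_norm_le ?_ (Eventually.of_forall fun y => ?_)
        · exact (Continuous.integrable_of_hasCompactSupport (by fun_prop)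
            (HasCompactSupport.of_compactSpace _))
        · have hn : ‖k' y‖ = k y := by
            change ‖(k y : ℂ)‖ = _
            rw [Complex.norm_real, Real.norm_of_nonneg (hk0 y)]
          rw [← sub_mul, norm_mul, hn]
          by_cases hy : y ∈ U
          · exact mul_le_mul_of_nonneg_right (hUf y hy x) (hk0 y)
          · simp [hkU y hy]
    _ = ε / 2 := by rw [integral_const_mul, hkint, mul_one]

theorem dense_toLp_image_coeffSpan [μ.IsOpenPosMeasure] {p : ℝ≥0∞} [Fact (1 ≤ p)]
    [μ.WeaklyRegular] (hp : p ≠ ⊤) :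
    Dense (ContinuousMap.toLp (E := ℂ) p μ ℂ '' (coeffSpan G : Set C(G, ℂ))) :=
  (ContinuousMap.toLp_denseRange ℂ μ ℂ hp).dense_image (ContinuousMap.toLp p μ ℂ).continuous
    (Submodule.dense_iff_topologicalClosure_eq_top.2 (topologicalClosure_coeffSpan_eq_top μ))

end PeterWeyl

/-! ### Exchanging a countable sum with the integral. -/

section Integration

open Filter

theorem ae_summable_and_integrable_tsum {α ι : Type*} [MeasurableSpace α] {μ : Measure α}
    [Countable ι] {g : ι → α → ℂ} (hg : ∀ i, AEStronglyMeasurable (g i) μ)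
    (h : ∑' i, ∫⁻ x, ‖g i x‖ₑ ∂μ ≠ ⊤) :
    (∀ᵐ x ∂μ, Summable fun i => g i x) ∧ Integrable (fun x => ∑' i, g i x) μ ∧
      HasSum (fun i => ∫ x, g i x ∂μ) (∫ x, ∑' i, g i x ∂μ) := by
  rw [← lintegral_tsum fun i => (hg i).enorm] at h
  have hs : ∀ᵐ x ∂μ, Summable fun i => g i x := by
    filter_upwards [ae_lt_top' (AEMeasurable.tsum fun i => (hg i).enorm) h] with x hx
    exact Summable.of_enorm hx.ne
  have hm : AEStronglyMeasurable (fun x => ∑' i, g i x) μ := by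
    refine aestronglyMeasurable_of_tendsto_ae (atTop : Filter (Finset ι))
      (f := fun s x => ∑ i ∈ s, g i x)
      (fun s => Finset.aestronglyMeasurable_fun_sum s fun i _ => hg i) ?_
    filter_upwards [hs] with x hx using hx.hasSum
  refine ⟨hs, ⟨hm, ?_⟩, ?_⟩
  · exact (lintegral_mono fun x => enorm_tsum_le_tsum_enorm).trans_lt h.lt_top
  · rw [lintegral_tsum fun i => (hg i).enorm] at h
    have hi : ∀ i, Integrable (g i) μ := fun i => ⟨hg i, (ENNReal.ne_top_of_tsum_ne_top h i).lt_top⟩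
    refine hasSum_integral_of_summable_integral_norm hi ?_
    simp only [integral_norm_eq_lintegral_enorm (hg _)]
    exact ENNReal.summable_toReal h

end Integration

/-! ### Spans of chosen representatives and norm bounds for coefficients. -/

namespace UnitaryIrrep

open ComplexConjugate

section Span

variable {G : Type*} [Group G] [TopologicalSpace G]

theorem coeff_mem_span_of_equivalent {ξ η : UnitaryIrrep G} (h : Equivalent ξ η)
    (k l : Fin η.dim) :
    η.coeff k l ∈ Submodule.span ℂ (Set.range fun ij : Fin ξ.dim × Fin ξ.dim =>
      ξ.coeff ij.1 ij.2) := by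
  obtain ⟨U, -, h2, h3⟩ := h
  have hη : ∀ x, η.mat x = U * ξ.mat x * Uᴴ := fun x => by
    rw [h3, Matrix.mul_assoc, h2, Matrix.mul_one]
  have : η.coeff k l = ∑ j, ∑ i, (U k i * Uᴴ j l) • ξ.coeff i j := by
    ext x
    simp only [coeff_apply, hη, Matrix.mul_apply, ContinuousMap.coe_sum, ContinuousMap.coe_smul,
      Finset.sum_apply, Pi.smul_apply, smul_eq_mul, Finset.sum_mul]
    exact Finset.sum_congr rfl fun j _ => Finset.sum_congr rfl fun i _ => by ring
  rw [this]
  exact Submodule.sum_mem _ fun j _ => Submodule.sum_mem _ fun i _ => Submodule.smul_mem _ _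
    (Submodule.subset_span ⟨(i, j), rfl⟩)

theorem coeffSpan_eq_span_rep {rep : UnitaryDual G → UnitaryIrrep G}
    (hrep : ∀ c, (rep c).cls = c) :
    coeffSpan G = Submodule.span ℂ (Set.range
      fun ι : Σ c, Fin (rep c).dim × Fin (rep c).dim => (rep ι.1).coeff ι.2.1 ι.2.2) := by
  apply le_antisymm
  · refine Submodule.span_le.2 ?_
    rintro _ ⟨η, k, l, rfl⟩
    have h : Equivalent (rep η.cls) η := Quotient.exact (hrep η.cls)
    refine Submodule.span_mono ?_ (coeff_mem_span_of_equivalent h k l)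
    rintro _ ⟨ij, rfl⟩
    exact ⟨⟨η.cls, ij⟩, rfl⟩
  · refine Submodule.span_mono ?_
    rintro _ ⟨ι, rfl⟩
    exact ⟨_, _, _, rfl⟩

theorem not_equivalent_rep {rep : UnitaryDual G → UnitaryIrrep G}
    (hrep : ∀ c, (rep c).cls = c) {c c' : UnitaryDual G} (hcc : c ≠ c') :
    ¬ Equivalent (rep c) (rep c') := fun h => by
  apply hcc
  rw [← hrep c, ← hrep c']
  exact Quotient.sound h

end Span

section Bounds

variable {G : Type*} [Group G] [TopologicalSpace G] [IsTopologicalGroup G] [CompactSpace G]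
  [MeasurableSpace G] [BorelSpace G] (μ : Measure G) [IsProbabilityMeasure μ]
  [μ.IsMulLeftInvariant]

theorem lintegral_enorm_coeff_sq (ξ : UnitaryIrrep G) (i j : Fin ξ.dim) :
    ∫⁻ x, ‖ξ.coeff i j x‖ₑ ^ (2 : ℝ) ∂μ = (ξ.dim : ℝ≥0∞)⁻¹ := by
  have hi : Integrable (fun x => ‖ξ.coeff i j x‖ ^ 2) μ :=
    Continuous.integrable_of_hasCompactSupport (by fun_prop) (HasCompactSupport.of_compactSpace _)
  have h := ofReal_integral_eq_lintegral_ofReal hi (Filter.Eventually.of_forall fun x => by positivity)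
  rw [integral_norm_coeff_sq, ENNReal.ofReal_inv_of_pos (Nat.cast_pos.2 ξ.dim_pos),
    ENNReal.ofReal_natCast] at h
  rw [h]
  refine lintegral_congr fun x => ?_
  rw [ENNReal.ofReal_pow (norm_nonneg _), ofReal_norm]
  norm_cast

/-- From `|ξ_ij| ≤ 1` and `q ≥ 2` follows `∫ |ξ_ij|^q ≤ ∫ |ξ_ij|² = 1/d`. -/
theorem eLpNorm_coeff_le (ξ : UnitaryIrrep G) (i j : Fin ξ.dim) {q : ℝ≥0∞} (hq : 2 ≤ q) :
    eLpNorm (ξ.coeff i j) q μ ≤ (ξ.dim : ℝ≥0∞) ^ (-(q⁻¹).toReal) := by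
  have hle : ∀ x, ‖ξ.coeff i j x‖ₑ ≤ 1 := fun x => by
    rw [← ofReal_norm]
    exact ENNReal.ofReal_le_one.2 (ξ.norm_mat_apply_le_one x i j)
  have hq0 : q ≠ 0 := fun h => by simp [h] at hq
  by_cases hqt : q = ⊤
  · subst hqt
    simp only [ENNReal.inv_top, ENNReal.toReal_zero, neg_zero, ENNReal.rpow_zero]
    rw [eLpNorm_exponent_top]
    exact essSup_le_of_ae_le _ (Filter.Eventually.of_forall hle)
  · have hq2 : 2 ≤ q.toReal := by
      simpa using ENNReal.toReal_mono hqt hq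
    rw [eLpNorm_eq_lintegral_rpow_enorm_toReal hq0 hqt, ENNReal.rpow_neg, ← ENNReal.inv_rpow,
      ENNReal.toReal_inv, one_div, ← lintegral_enorm_coeff_sq μ ξ i j]
    refine ENNReal.rpow_le_rpow (lintegral_mono fun x => ?_) (by positivity)
    exact ENNReal.rpow_le_rpow_of_exponent_ge (hle x) hq2

/-- Hölder is applied with `s = min 2 p` instead of `p`, so that the conjugate exponent is at least
2. Passing from `‖f‖_s` to `‖f‖_p` is free on a probability space. -/
theorem lintegral_enorm_conj_coeff_mul_le (ξ : UnitaryIrrep G) (i j : Fin ξ.dim) {p : ℝ≥0∞}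
    (hp1 : 1 ≤ p) (hp : p ≠ ⊤) {f : G → ℂ} (hf : AEStronglyMeasurable f μ) :
    ∫⁻ x, ‖conj (ξ.mat x i j) * f x‖ₑ ∂μ ≤
      (ξ.dim : ℝ≥0∞) ^ (1 / min 2 p.toReal - 1) * eLpNorm f p μ := by
  set s : ℝ≥0∞ := min 2 p
  have hs1 : 1 ≤ s := le_min (by norm_num) hp1
  have hst : s ≠ ⊤ := ne_top_of_le_ne_top hp (min_le_right _ _)
  set q := s.conjExponent
  have hconj : s.HolderConjugate q := .conjExponent hs1
  have hsum : s⁻¹ + q⁻¹ = 1 := ENNReal.HolderConjugate.inv_add_inv_eq_one s q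
  have hqi : q⁻¹ ≠ ⊤ := ne_top_of_le_ne_top ENNReal.one_ne_top (hsum ▸ le_add_self)
  have hsi : s⁻¹ ≠ ⊤ := ne_top_of_le_ne_top ENNReal.one_ne_top (hsum ▸ le_self_add)
  have hsr : s.toReal = min 2 p.toReal := by
    rw [ENNReal.toReal_min (by simp) hp]; simp
  have hq' : -(q⁻¹).toReal = 1 / min 2 p.toReal - 1 := by
    have := congrArg ENNReal.toReal hsum
    rw [ENNReal.toReal_add hsi hqi, ENNReal.toReal_one, ENNReal.toReal_inv s, hsr] at this
    rw [one_div]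
    linarith
  have hq2 : 2 ≤ q := by
    rw [← ENNReal.inv_le_inv]
    have h2 : (2 : ℝ≥0∞)⁻¹ ≤ s⁻¹ := ENNReal.inv_le_inv.2 (min_le_left _ _)
    have h3 : s⁻¹ + q⁻¹ ≤ s⁻¹ + 2⁻¹ := by
      rw [hsum, ← ENNReal.inv_two_add_inv_two]
      gcongr
    exact (ENNReal.add_le_add_iff_left hsi).1 h3
  have hconj' : q.HolderConjugate s := hconj.symm
  have hc : Continuous fun x => conj (ξ.coeff i j x) := by fun_prop
  have hH := eLpNorm_smul_le_mul_eLpNorm (r := 1) hf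
    (hc.aestronglyMeasurable_of_compactSpace (μ := μ)) (p := q) (q := s)
  rw [eLpNorm_one_eq_lintegral_enorm] at hH
  refine hH.trans ?_
  gcongr
  · rw [← hq']
    refine le_trans (le_of_eq ?_) (eLpNorm_coeff_le μ ξ i j hq2)
    exact eLpNorm_congr_norm_ae (Filter.Eventually.of_forall fun x => by simp)
  · exact eLpNorm_le_eLpNorm_of_exponent_le (min_le_right _ _) hf

end Bounds

end UnitaryIrrep

/-! ### Bounding `A(ξ_ij)` by the symbol. -/

section SymbolBounds

variable {G : Type*} [Group G] [TopologicalSpace G] [CompactSpace G] [MeasurableSpace G]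
  [BorelSpace G] {μ : Measure G} [IsFiniteMeasure μ] {p : ℝ≥0∞} [Fact (1 ≤ p)]

open ComplexConjugate

theorem mat_mul_matrixSymbol (A : Lp ℂ p μ →L[ℂ] Lp ℂ p μ) (ξ : UnitaryIrrep G) (x : G) :
    ξ.mat x * matrixSymbol A ξ x =
      Matrix.of fun i j => (A (ContinuousMap.toLp p μ ℂ (ξ.coeff i j)) : G → ℂ) x := by
  rw [matrixSymbol, ← Matrix.mul_assoc, ξ.mat_mul_conjTranspose_mat, Matrix.one_mul]

theorem trace_matrixSymbol (A : Lp ℂ p μ →L[ℂ] Lp ℂ p μ) (ξ : UnitaryIrrep G) (x : G) :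
    (matrixSymbol A ξ x).trace = ∑ ij : Fin ξ.dim × Fin ξ.dim, conj (ξ.mat x ij.1 ij.2) *
      (A (ContinuousMap.toLp p μ ℂ (ξ.coeff ij.1 ij.2)) : G → ℂ) x := by
  rw [Fintype.sum_prod_type_right]
  rfl

theorem sum_norm_le_opNormLinfty {d : ℕ} (B : Matrix (Fin d) (Fin d) ℂ) (i : Fin d) :
    ∑ j, ‖B i j‖ ≤ opNormLinfty B :=
  le_ciSup (f := fun i => ∑ j, ‖B i j‖) (Set.finite_range _).bddAbove i

/-- Pointwise, `(Aξ)_ij = ∑ₖ ξ_ik σ_kj` is bounded by the `j`-th row sum of the transposed symbol.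
-/
theorem enorm_apply_coeff_le (A : Lp ℂ p μ →L[ℂ] Lp ℂ p μ) (ξ : UnitaryIrrep G)
    (i j : Fin ξ.dim) :
    ‖A (ContinuousMap.toLp p μ ℂ (ξ.coeff i j))‖ₑ ≤
      eLpNorm (fun x => opNormLinfty (matrixSymbol A ξ x)ᵀ) p μ := by
  rw [Lp.enorm_def]
  refine eLpNorm_mono_real fun x => ?_
  have h := congrFun (congrFun (mat_mul_matrixSymbol A ξ x) i) j
  rw [Matrix.of_apply] at h
  rw [← h, Matrix.mul_apply]
  calc ‖∑ k, ξ.mat x i k * matrixSymbol A ξ x k j‖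
      ≤ ∑ k, ‖(matrixSymbol A ξ x)ᵀ j k‖ := by
        refine norm_sum_le_of_le _ fun k _ => ?_
        rw [norm_mul]
        exact mul_le_of_le_one_left (norm_nonneg _) (ξ.norm_mat_apply_le_one x i k)
    _ ≤ _ := sum_norm_le_opNormLinfty _ _

end SymbolBounds

/-! ### Fourier coefficient functionals, dual to the matrix coefficients. -/

section CoeffFunctional

open ComplexConjugate

variable {G : Type*} [Group G] [TopologicalSpace G] [IsTopologicalGroup G] [CompactSpace G]
  [MeasurableSpace G] [BorelSpace G] (μ : Measure G) [IsProbabilityMeasure μ]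
  [μ.IsMulLeftInvariant] {p : ℝ≥0∞} [Fact (1 ≤ p)]

namespace UnitaryIrrep

theorem natCast_mul_lintegral_conj_coeff_mul_le (ξ : UnitaryIrrep G) (i j : Fin ξ.dim)
    (hp : p ≠ ⊤) (f : Lp ℂ p μ) :
    ∫⁻ x, ‖(ξ.dim : ℂ) * (conj (ξ.mat x i j) * f x)‖ₑ ∂μ ≤
      ENNReal.ofReal ((ξ.dim : ℝ) ^ (1 / min 2 p.toReal) * ‖f‖) := by
  have hd : (ξ.dim : ℝ≥0∞) ≠ 0 := Nat.cast_ne_zero.2 ξ.dim_pos.ne'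
  simp only [enorm_mul (ξ.dim : ℂ)]
  rw [lintegral_const_mul' _ _ enorm_ne_top]
  calc ‖(ξ.dim : ℂ)‖ₑ * ∫⁻ x, ‖conj (ξ.mat x i j) * f x‖ₑ ∂μ
      ≤ (ξ.dim : ℝ≥0∞) * ((ξ.dim : ℝ≥0∞) ^ (1 / min 2 p.toReal - 1) * eLpNorm f p μ) := by
        gcongr
        · rw [← ofReal_norm, Complex.norm_natCast, ENNReal.ofReal_natCast]
        · exact ξ.lintegral_enorm_conj_coeff_mul_le μ i j Fact.out hp (Lp.aestronglyMeasurable f)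
    _ = _ := by
        nth_rewrite 1 [← ENNReal.rpow_one (ξ.dim : ℝ≥0∞)]
        rw [← mul_assoc, ← ENNReal.rpow_add _ _ hd (ENNReal.natCast_ne_top _), add_sub_cancel,
          ENNReal.ofReal_mul (by positivity), ← ENNReal.ofReal_rpow_of_pos
          (Nat.cast_pos.2 ξ.dim_pos), ENNReal.ofReal_natCast, ofReal_norm, Lp.enorm_def]

theorem integrable_conj_coeff_mul (ξ : UnitaryIrrep G) (i j : Fin ξ.dim)
    (hp : p ≠ ⊤) (f : Lp ℂ p μ) :
    Integrable (fun x => (ξ.dim : ℂ) * (conj (ξ.mat x i j) * f x)) μ := by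
  have hc : Continuous fun x => conj (ξ.coeff i j x) := by fun_prop
  refine ⟨((hc.aestronglyMeasurable_of_compactSpace (μ := μ)).mul
    (Lp.aestronglyMeasurable f)).const_mul _, ?_⟩
  exact (ξ.natCast_mul_lintegral_conj_coeff_mul_le μ i j hp f).trans_lt ENNReal.ofReal_lt_top

/-- The functional `f ↦ d_ξ ∫ conj(ξ_{ij}) f dμ` on `L^p`. -/
def coeffFunctional (ξ : UnitaryIrrep G) (i j : Fin ξ.dim) (hp : p ≠ ⊤) : Lp ℂ p μ →L[ℂ] ℂ :=
  LinearMap.mkContinuous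
    { toFun := fun f => ∫ x, (ξ.dim : ℂ) * (conj (ξ.mat x i j) * f x) ∂μ
      map_add' := fun f g => by
        rw [← integral_add (ξ.integrable_conj_coeff_mul μ i j hp f)
          (ξ.integrable_conj_coeff_mul μ i j hp g)]
        refine integral_congr_ae ?_
        filter_upwards [Lp.coeFn_add f g] with x hx
        rw [hx, Pi.add_apply]
        ring
      map_smul' := fun c f => by
        rw [RingHom.id_apply, smul_eq_mul, ← integral_const_mul]
        refine integral_congr_ae ?_
        filter_upwards [Lp.coeFn_smul c f] with x hx
        rw [hx, Pi.smul_apply, smul_eq_mul]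
        ring }
    ((ξ.dim : ℝ) ^ (1 / min 2 p.toReal)) fun f => by
      refine (norm_integral_le_lintegral_norm _).trans ?_
      refine ENNReal.toReal_le_of_le_ofReal (by positivity) ?_
      simpa only [ofReal_norm] using ξ.natCast_mul_lintegral_conj_coeff_mul_le μ i j hp f

theorem coeffFunctional_apply (ξ : UnitaryIrrep G) (i j : Fin ξ.dim) (hp : p ≠ ⊤) (f : Lp ℂ p μ) :
    ξ.coeffFunctional μ i j hp f = ∫ x, (ξ.dim : ℂ) * (conj (ξ.mat x i j) * f x) ∂μ := rfl

theorem norm_coeffFunctional_le (ξ : UnitaryIrrep G) (i j : Fin ξ.dim) (hp : p ≠ ⊤) :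
    ‖ξ.coeffFunctional μ i j hp‖ ≤ (ξ.dim : ℝ) ^ (1 / min 2 p.toReal) :=
  LinearMap.mkContinuous_norm_le _ (by positivity) _

omit [IsTopologicalGroup G] [μ.IsMulLeftInvariant] in
theorem integral_conj_mul_toLp (ξ η : UnitaryIrrep G) (i j : Fin ξ.dim) (k l : Fin η.dim) :
    ∫ x, (ξ.dim : ℂ) * (conj (ξ.mat x i j) * ContinuousMap.toLp p μ ℂ (η.coeff k l) x) ∂μ =
      ξ.dim * ∫ x, η.mat x k l * conj (ξ.mat x i j) ∂μ := by
  rw [integral_const_mul]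
  congr 1
  refine integral_congr_ae ?_
  filter_upwards [ContinuousMap.coeFn_toLp (p := p) (𝕜 := ℂ) μ (η.coeff k l)] with x hx
  rw [hx, coeff_apply, mul_comm]

theorem coeffFunctional_coeff_self (ξ : UnitaryIrrep G) (i j k l : Fin ξ.dim) (hp : p ≠ ⊤) :
    ξ.coeffFunctional μ i j hp (ContinuousMap.toLp p μ ℂ (ξ.coeff k l)) =
      if k = i ∧ l = j then 1 else 0 := by
  have hd : (ξ.dim : ℂ) ≠ 0 := Nat.cast_ne_zero.2 ξ.dim_pos.ne'
  rw [coeffFunctional_apply, integral_conj_mul_toLp, integral_mul_conj_self]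
  split_ifs <;> simp [hd]

theorem coeffFunctional_coeff_of_not_equivalent {ξ η : UnitaryIrrep G} (h : ¬ Equivalent η ξ)
    (i j : Fin ξ.dim) (k l : Fin η.dim) (hp : p ≠ ⊤) :
    ξ.coeffFunctional μ i j hp (ContinuousMap.toLp p μ ℂ (η.coeff k l)) = 0 := by
  rw [coeffFunctional_apply, integral_conj_mul_toLp, integral_mul_conj_of_not_equivalent μ h,
    mul_zero]

end UnitaryIrrep

end CoeffFunctional

/-! ### Fourier expansion of the operator, nuclearity and the trace formula. -/

section Main

open ComplexConjugate UnitaryIrrep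

variable {G : Type*} [Group G] [TopologicalSpace G] [IsTopologicalGroup G] [CompactSpace G]
  [SecondCountableTopology G]
  [MeasurableSpace G] [BorelSpace G] (μ : Measure G) [μ.IsHaarMeasure] [IsProbabilityMeasure μ]
  {p : ℝ≥0∞} [Fact (1 ≤ p)]

/-- The index set of the matrix coefficients of a system of representatives. -/
abbrev CoeffIndex (rep : UnitaryDual G → UnitaryIrrep G) : Type _ :=
  Σ c, Fin (rep c).dim × Fin (rep c).dim

/-- The Fourier expansion of an operator whose nuclear norm series converges. -/
theorem hasSum_coeffFunctional_smul (hp : p ≠ ⊤) {rep : UnitaryDual G → UnitaryIrrep G}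
    (hrep : ∀ c, (rep c).cls = c) (A : Lp ℂ p μ →L[ℂ] Lp ℂ p μ)
    (hs : Summable fun ι : CoeffIndex rep => ‖(rep ι.1).coeffFunctional μ ι.2.1 ι.2.2 hp‖ *
      ‖A (ContinuousMap.toLp p μ ℂ ((rep ι.1).coeff ι.2.1 ι.2.2))‖) (f : Lp ℂ p μ) :
    HasSum (fun ι : CoeffIndex rep => (rep ι.1).coeffFunctional μ ι.2.1 ι.2.2 hp f •
      A (ContinuousMap.toLp p μ ℂ ((rep ι.1).coeff ι.2.1 ι.2.2))) (A f) := by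
  classical
  let Q : CoeffIndex rep → Lp ℂ p μ →L[ℂ] Lp ℂ p μ := fun ι =>
    ((rep ι.1).coeffFunctional μ ι.2.1 ι.2.2 hp).smulRight
      (A (ContinuousMap.toLp p μ ℂ ((rep ι.1).coeff ι.2.1 ι.2.2)))
  have hQ : Summable Q := Summable.of_norm (by
    simpa only [Q, ContinuousLinearMap.norm_smulRight_apply] using hs)
  have hQf : ∀ f, HasSum (fun ι => Q ι f) ((∑' ι, Q ι) f) := fun f =>
    hQ.hasSum.mapL (ContinuousLinearMap.apply ℂ (Lp ℂ p μ) f)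
  -- Operator-norm convergence makes the sum a continuous operator, so comparison with `A` on the
  -- dense span of coefficients is enough.
  suffices h : ∑' ι, Q ι = A by
    have := hQf f
    rwa [h] at this
  refine DFunLike.coe_injective (Continuous.ext_on (dense_toLp_image_coeffSpan μ hp)
    (ContinuousLinearMap.continuous _) (ContinuousLinearMap.continuous _) ?_)
  rintro _ ⟨g, hg, rfl⟩
  rw [SetLike.mem_coe, coeffSpan_eq_span_rep hrep] at hg
  induction hg using Submodule.span_induction with
  | mem g hg =>
    obtain ⟨⟨c, k, l⟩, rfl⟩ := hg
    have h1 : HasSum (fun ι => Q ι (ContinuousMap.toLp p μ ℂ ((rep c).coeff k l)))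
        (Q ⟨c, k, l⟩ (ContinuousMap.toLp p μ ℂ ((rep c).coeff k l))) := by
      refine hasSum_single _ ?_
      rintro ⟨c', i, j⟩ hne
      by_cases hc : c' = c
      · subst hc
        have : ¬ (k = i ∧ l = j) := by
          rintro ⟨rfl, rfl⟩
          exact hne rfl
        simp only [Q, ContinuousLinearMap.smulRight_apply]
        rw [coeffFunctional_coeff_self, if_neg this, zero_smul]
      · simp only [Q, ContinuousLinearMap.smulRight_apply]
        rw [coeffFunctional_coeff_of_not_equivalent μ (not_equivalent_rep hrep (Ne.symm hc)),
          zero_smul]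
    refine ((hQf _).unique h1).trans ?_
    simp only [Q, ContinuousLinearMap.smulRight_apply]
    rw [coeffFunctional_coeff_self, if_pos ⟨rfl, rfl⟩, one_smul]
  | zero => simp only [map_zero]
  | add g g' _ _ h h' => simp only [map_add, h, h']
  | smul a g _ h => simp only [map_smul, h]

omit [IsTopologicalGroup G] [SecondCountableTopology G] [μ.IsHaarMeasure] in
theorem summable_rpow_of_symbol {r : ℝ} (hr0 : 0 < r)
    (rep : UnitaryDual G → UnitaryIrrep G) (A : Lp ℂ p μ →L[ℂ] Lp ℂ p μ)
    (hA : ∑' c : UnitaryDual G,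
        ((rep c).dim : ℝ≥0∞) ^ (2 + r / min 2 p.toReal) *
          eLpNorm (fun x => opNormLinfty (matrixSymbol A (rep c) x)ᵀ) p μ ^ r < ⊤) :
    Summable fun ι : CoeffIndex rep => (((rep ι.1).dim : ℝ) ^ (1 / min 2 p.toReal) *
      ‖A (ContinuousMap.toLp p μ ℂ ((rep ι.1).coeff ι.2.1 ι.2.2))‖) ^ r := by
  have hle : ∀ ι : CoeffIndex rep, ENNReal.ofReal ((((rep ι.1).dim : ℝ) ^ (1 / min 2 p.toReal) *
      ‖A (ContinuousMap.toLp p μ ℂ ((rep ι.1).coeff ι.2.1 ι.2.2))‖) ^ r) ≤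
      ((rep ι.1).dim : ℝ≥0∞) ^ (r / min 2 p.toReal) *
          eLpNorm (fun x => opNormLinfty (matrixSymbol A (rep ι.1) x)ᵀ) p μ ^ r := fun ι => by
    rw [← ENNReal.ofReal_rpow_of_nonneg (by positivity) hr0.le, ENNReal.ofReal_mul (by positivity),
      ENNReal.mul_rpow_of_nonneg _ _ hr0.le, ← ENNReal.ofReal_rpow_of_pos
      (Nat.cast_pos.2 (rep ι.1).dim_pos), ENNReal.ofReal_natCast, ← ENNReal.rpow_mul, ofReal_norm,
      one_div_mul_eq_div]
    gcongr
    exact enorm_apply_coeff_le A _ _ _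
  have hfin : ∑' ι : CoeffIndex rep, ENNReal.ofReal ((((rep ι.1).dim : ℝ) ^ (1 / min 2 p.toReal) *
      ‖A (ContinuousMap.toLp p μ ℂ ((rep ι.1).coeff ι.2.1 ι.2.2))‖) ^ r) ≠ ⊤ := by
    refine ne_top_of_le_ne_top hA.ne ((ENNReal.tsum_le_tsum hle).trans ?_)
    rw [ENNReal.tsum_sigma']
    refine ENNReal.tsum_le_tsum fun c => le_of_eq ?_
    have hd : ((rep c).dim : ℝ≥0∞) ≠ 0 := Nat.cast_ne_zero.2 (rep c).dim_pos.ne'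
    -- The bound is independent of `i, j`, so the `d²` pairs supply the factor `d ^ 2`.
    simp only [tsum_fintype, Finset.sum_const, Finset.card_univ, Fintype.card_prod,
      Fintype.card_fin, nsmul_eq_mul]
    rw [ ENNReal.rpow_add _ _ hd (ENNReal.natCast_ne_top _), ENNReal.rpow_two, ← mul_assoc]
    push_cast
    rw [sq]
  refine (ENNReal.summable_toReal hfin).congr fun ι => ?_
  rw [ENNReal.toReal_ofReal (by positivity)]

theorem nuclear_of_summable_symbol {r : ℝ} (hr0 : 0 < r) (hr1 : r ≤ 1) (hp : p ≠ ⊤)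
    {rep : UnitaryDual G → UnitaryIrrep G} (hrep : ∀ c, (rep c).cls = c)
    (A : Lp ℂ p μ →L[ℂ] Lp ℂ p μ)
    (hA : ∑' c : UnitaryDual G,
        ((rep c).dim : ℝ≥0∞) ^ (2 + r / min 2 p.toReal) *
          eLpNorm (fun x => opNormLinfty (matrixSymbol A (rep c) x)ᵀ) p μ ^ r < ⊤) :
    IsRNuclear r A ∧
      (∀ᵐ x ∂μ, Summable fun c : UnitaryDual G =>
        ((rep c).dim : ℂ) * (matrixSymbol A (rep c) x).trace) ∧
      Integrable (fun x => ∑' c : UnitaryDual G,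
        ((rep c).dim : ℂ) * (matrixSymbol A (rep c) x).trace) μ ∧
      HasNuclearTrace A (∫ x, ∑' c : UnitaryDual G,
        ((rep c).dim : ℂ) * (matrixSymbol A (rep c) x).trace ∂μ) := by
  have : Countable (UnitaryDual G) := UnitaryDual.countable μ
  let x' : CoeffIndex rep → Lp ℂ p μ →L[ℂ] ℂ := fun ι =>
    (rep ι.1).coeffFunctional μ ι.2.1 ι.2.2 hp
  let y : CoeffIndex rep → Lp ℂ p μ := fun ι =>
    A (ContinuousMap.toLp p μ ℂ ((rep ι.1).coeff ι.2.1 ι.2.2))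
  -- The integrand of `x' ι (y ι)`; its sum over one class is the trace term of the symbol.
  let g : CoeffIndex rep → G → ℂ := fun ι x =>
    ((rep ι.1).dim : ℂ) * (conj ((rep ι.1).mat x ι.2.1 ι.2.2) * y ι x)
  have hbr := summable_rpow_of_symbol μ hr0 rep A hA
  have hb := Summable.of_rpow_of_le_one (fun ι => by positivity) hr0 hr1 hbr
  have hx' : ∀ ι, ‖x' ι‖ ≤ ((rep ι.1).dim : ℝ) ^ (1 / min 2 p.toReal) := fun ι =>
    norm_coeffFunctional_le μ _ _ _ hp
  have hxy : Summable fun ι => ‖x' ι‖ ^ r * ‖y ι‖ ^ r := by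
    refine Summable.of_nonneg_of_le (fun ι => by positivity) (fun ι => ?_) hbr
    rw [← Real.mul_rpow (norm_nonneg _) (norm_nonneg _)]
    exact Real.rpow_le_rpow (by positivity)
      (mul_le_mul_of_nonneg_right (hx' ι) (norm_nonneg _)) hr0.le
  obtain ⟨X', Y, hXY, htr⟩ := exists_isNuclearRepresentation_of_countable hr0 x' y
    (hasSum_coeffFunctional_smul μ hp hrep A (summable_norm_mul_norm_of_rpow hr0 hr1 hxy)) hxy
  have hgi : ∀ ι, Integrable (g ι) μ := fun ι => integrable_conj_coeff_mul μ _ _ _ hp _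
  have hg : ∑' ι, ∫⁻ x, ‖g ι x‖ₑ ∂μ ≠ ⊤ := by
    refine ne_top_of_le_ne_top hb.tsum_ofReal_ne_top (ENNReal.tsum_le_tsum fun ι => ?_)
    exact natCast_mul_lintegral_conj_coeff_mul_le μ _ _ _ hp _
  obtain ⟨hgs, hgint, hgsum⟩ := ae_summable_and_integrable_tsum (fun ι => (hgi ι).1) hg
  have hfib : ∀ x c, HasSum (fun ij => g ⟨c, ij⟩ x)
      (((rep c).dim : ℂ) * (matrixSymbol A (rep c) x).trace) := fun x c => by
    rw [trace_matrixSymbol, Finset.mul_sum]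
    exact hasSum_fintype _
  have htsum : (fun x => ∑' ι, g ι x) =ᵐ[μ] fun x => ∑' c : UnitaryDual G,
      ((rep c).dim : ℂ) * (matrixSymbol A (rep c) x).trace := by
    filter_upwards [hgs] with x hx
    exact (hx.hasSum.sigma (hfib x)).tsum_eq.symm
  refine ⟨⟨X', Y, hXY⟩, ?_, hgint.congr htsum, ?_⟩
  · filter_upwards [hgs] with x hx
    exact (hx.hasSum.sigma (hfib x)).summable
  · rw [← integral_congr_ae htsum]
    have hT := (hXY.one_of_le_one hr0 hr1).hasNuclearTrace (hasMetricApproximationProperty_Lp hp)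
    -- Evaluation as the pairing turns the reindexed sum into the trace series of the Fourier
    -- representation, whose sum is the integral.
    have hS := (htr (fun φ v => φ v) _ (map_zero _) hgsum).tsum_eq
    rwa [hS] at hT

end Main
end

theorem mainTheorem2
    {n : ℕ} {G : Type*} [TopologicalSpace G] [ChartedSpace (EuclideanSpace ℝ (Fin n)) G]
    [Group G] [LieGroup (𝓡 n) ∞ G] [CompactSpace G] [T2Space G]
    [MeasurableSpace G] [BorelSpace G]
    (μ : Measure G) [μ.IsHaarMeasure] [IsProbabilityMeasure μ]
    (r : ℝ) (hr0 : 0 < r) (hr1 : r ≤ 1)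
    (p : ℝ≥0∞) [Fact (1 ≤ p)] (hp : p ≠ ⊤)
    (rep : UnitaryDual G → UnitaryIrrep G) (hrep : ∀ c, (rep c).cls = c)
    (A : Lp ℂ p μ →L[ℂ] Lp ℂ p μ)
    (hA : ∑' c : UnitaryDual G,
        ((rep c).dim : ℝ≥0∞) ^ (2 + r / min 2 p.toReal) *
          eLpNorm (fun x => opNormLinfty (matrixSymbol A (rep c) x)ᵀ) p μ ^ r < ⊤) :
    IsRNuclear r A ∧
      (∀ᵐ x ∂μ, Summable fun c : UnitaryDual G =>
        ((rep c).dim : ℂ) * (matrixSymbol A (rep c) x).trace) ∧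
      Integrable (fun x => ∑' c : UnitaryDual G,
        ((rep c).dim : ℂ) * (matrixSymbol A (rep c) x).trace) μ ∧
      HasNuclearTrace A (∫ x, ∑' c : UnitaryDual G,
        ((rep c).dim : ℂ) * (matrixSymbol A (rep c) x).trace ∂μ) := by
  have : IsTopologicalGroup G := topologicalGroup_of_lieGroup (𝓡 n) ∞
  have : SecondCountableTopology G :=
    ChartedSpace.secondCountable_of_sigmaCompact (EuclideanSpace ℝ (Fin n)) G
  exact nuclear_of_summable_symbol μ hr0 hr1 hp hrep A hA
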